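/- **The model.** An instance of the (explicit, finite) *distributed Lovász local lemma* with $n$ events consists of mutually independent discrete random variables with finite ranges and given laws, and of events $E_1,\dots,E_n$. Write $\mathrm{vbl}(E_v)$ for the finite set of variables on which $E_v$ depends. The *dependency graph* has the events as nodes; two distinct events are adjacent if and only if they share a variable. It is assumed to be connected. Let $d$ be its maximum degree. The instance satisfies the criterion $p\,f(d)\le 1$ if this inequality holds for some real number $p$ with $\Pr(E_v)\le p$ for all $v$. The dependency graph is also the communication network. Initially, node $v$ knows $n$, $d$, its number of neighbours (which it addresses through arbitrarily numbered ports), the names (natural numbers) and the laws of the variables in $\mathrm{vbl}(E_v)$, the list of all combinations of values of these variables for which $E_v$ occurs, and a private random number, uniform in $[0,1]$ and independent of those of the other nodes. All nodes run the same algorithm (LOCAL model): in each synchronous round every node sends a message of arbitrary size to each neighbour, receives the messages of its neighbours, and performs an arbitrary local computation. After $T(n)$ rounds, where $T\colon\mathbb N\to\mathbb N$, every node $v$ outputs an assignment $a_v$ of values to the variables in $\mathrm{vbl}(E_v)$ (measurable as a function of the random numbers). The output is *correct* if every value lies in the range of its variable, adjacent nodes agree on their common variables, and for no $v$ does $E_v$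 occur under $a_v$. **Theorem.** Let $f\colon\mathbb N\to\mathbb R$ be such that $f(4)\le 16$ (for example, $f(d)=e(d+1)$ or $f(d)=4d$), and let $c>0$. Let $A$ be a Monte Carlo algorithm as above with running time $T$ that, on every instance with the criterion $p\,f(d)\le 1$, for every port numbering, produces a correct output with probability at least $1-1/n^c$, where $n$ is the number of events. Then $T(n)=\Omega(\log\log n)$, that is, $\log\log n = O(T(n))$ as $n\to\infty$. The same conclusion holds if, for some $D\ge 4$, this is only assumed for the instances whose dependency graph has maximum degree at most $D$. -/

import Mathlib

open MeasureTheory Filter Asymptotics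

/-- An instance of the explicit, finite distributed Lovász local lemma with `n` events
`E_v`, `v : Fin n`.  The random variables are named by natural numbers; they are mutually
independent, the variable `X` has law `law X`, and its (finite) range is the support of that law.
`vbl v` is the set of variables that `E_v` depends on, and `bad v` lists explicitly the
combinations of values of these variables for which `E_v` occurs. -/
structure LLLInstance (n : ℕ) where
  law : ℕ → PMF ℕ
  finite_range : ∀ X, (law X).support.Finite
  vbl : Fin n → Finset ℕ
  bad : (v : Fin n) → Set (vbl v → ℕ)
  /-- `E_v` really depends on every variable of `vbl v`: changing the value of this variable alone
  can make the difference between occurrence and non-occurrence. -/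
  depends : ∀ (v : Fin n) (X : vbl v), ∃ a b : vbl v → ℕ,
    (∀ Y : vbl v, a Y ∈ (law Y).support) ∧ (∀ Y : vbl v, b Y ∈ (law Y).support) ∧
      (∀ Y, Y ≠ X → a Y = b Y) ∧ a ∈ bad v ∧ b ∉ bad v

/-- What a node knows initially about the instance: the number of its neighbours, and the names of
the variables of its event, their laws, and the combinations of values for which it occurs. -/
structure LocalInput where
  degree : ℕ
  vbl : Finset ℕ
  law : vbl → PMF ℕ
  bad : Set (vbl → ℕ)

namespace LLLInstance

variable {n : ℕ} (I : LLLInstance n)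

/-- The dependency graph, which is also the communication graph: two distinct events are adjacent
iff they share a variable. -/
def depGraph : SimpleGraph (Fin n) where
  Adj u v := u ≠ v ∧ ¬ Disjoint (I.vbl u) (I.vbl v)
  symm := ⟨fun _ _ h => ⟨h.1.symm, fun h' => h.2 h'.symm⟩⟩
  loopless := ⟨fun _ h => h.1 rfl⟩

instance : DecidableRel I.depGraph.Adj := fun u v =>
  inferInstanceAs (Decidable (u ≠ v ∧ ¬ Disjoint (I.vbl u) (I.vbl v)))

/-- The probability of `E_v` when the variables are sampled independently from their laws. -/
noncomputable def prob (v : Fin n) : ℝ :=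
  (Measure.pi fun X : I.vbl v => (I.law X).toMeasure).real (I.bad v)

/-- The criterion `p * f d ≤ 1`: `d` is the maximum degree of the dependency graph and `p` is an
upper bound on the probabilities of the events. -/
def Criterion (f : ℕ → ℝ) : Prop :=
  ∃ p : ℝ, (∀ v, I.prob v ≤ p) ∧ p * f I.depGraph.maxDegree ≤ 1

/-- A family `a` of outputs (`a v X` is the value that node `v` assigns to its variable `X`) is a
solution if all values lie in the ranges of the variables, adjacent nodes agree on their common
variables, and no event `E_v` occurs under the assignment of node `v`. -/
def IsSolution (a : Fin n → ℕ → ℕ) : Prop :=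
  (∀ v, ∀ X ∈ I.vbl v, a v X ∈ (I.law X).support) ∧
  (∀ u v, I.depGraph.Adj u v → ∀ X ∈ I.vbl u ∩ I.vbl v, a u X = a v X) ∧
  ∀ v, (fun X : I.vbl v => a v X) ∉ I.bad v

/-- The local input of node `v`. -/
def localInput (v : Fin n) : LocalInput where
  degree := I.depGraph.degree v
  vbl := I.vbl v
  law := fun X => I.law X
  bad := I.bad v

/-- A port numbering: every node numbers its neighbours, in an arbitrary way. -/
abbrev PortNumbering : Type :=
  (v : Fin n) → Fin (I.depGraph.degree v) ≃ I.depGraph.neighborSet v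

end LLLInstance

/-- An algorithm in the (randomised) LOCAL model, run by all nodes.  States and messages are
arbitrary, and local computation is unbounded. -/
structure LocalAlgorithm where
  State : Type
  Msg : Type
  /-- The initial state, from the number `n` of nodes, the maximum degree of the graph, the local
  input and a uniformly random real number in `[0, 1]`. -/
  init : (n Δ : ℕ) → LocalInput → unitInterval → State
  /-- The message that a node in a given state sends through a given port. -/
  send : State → ℕ → Msg
  /-- The new state, from the old one and the list of received messages, in the order of the
  ports. -/
  receive : State → List Msg → State
  /-- The output: a value for every variable (only those of the node's own event count). -/
  output : State → ℕ → ℕ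

namespace LocalAlgorithm

variable (A : LocalAlgorithm) {n : ℕ} (I : LLLInstance n)

/-- The state of every node after `t` synchronous communication rounds on the instance `I` with
port numbering `P`, when `x v` is the random number of node `v`. -/
def stateAfter (P : I.PortNumbering) (x : Fin n → unitInterval) : ℕ → Fin n → A.State
  | 0, v => A.init n I.depGraph.maxDegree (I.localInput v) (x v)
  | t + 1, v => A.receive (stateAfter P x t v) <| List.ofFn fun i : Fin (I.depGraph.degree v) =>
      A.send (stateAfter P x t (P v i)) ((P (P v i)).symm ⟨v, I.depGraph.adj_symm (P v i).2⟩)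

/-- The outputs of all nodes after `t` communication rounds. -/
def run (P : I.PortNumbering) (x : Fin n → unitInterval) (t : ℕ) (v : Fin n) : ℕ → ℕ :=
  A.output (A.stateAfter I P x t v)

/-- `A` is a Monte Carlo algorithm with running time `T` for the distributed Lovász local lemma
under the criterion `p * f d ≤ 1` in graphs of maximum degree at most `D` (no restriction if
`D = ⊤`): on every such instance with `n` events and a connected dependency graph, and for
every port numbering, the values that the nodes output after `T n` rounds are random variables, and
they form a solution with probability at least `1 - 1 / n ^ c`. The random numbers of the nodes
are independent and uniform in `[0, 1]`. -/
def SolvesLLL (f : ℕ → ℝ) (D : ℕ∞) (T : ℕ → ℕ) (c : ℝ) : Prop :=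
  ∀ (n : ℕ) (I : LLLInstance n), I.depGraph.Connected → I.Criterion f →
    (I.depGraph.maxDegree : ℕ∞) ≤ D → ∀ P : I.PortNumbering,
      (∀ v, ∀ X ∈ I.vbl v, Measurable fun x => A.run I P x (T n) v X) ∧
      1 - 1 / (n : ℝ) ^ c ≤
        (volume : Measure (Fin n → unitInterval)).real {x | I.IsSolution (A.run I P x (T n))}

end LocalAlgorithm

/-! Sinkless orientation of a 4-regular tree is an instance of the local lemma: every edge is a fair
coin, and `E_v` says that all four edges at `v` point to `v`. So `p = 1 / 16`, and `f 4 ≤ 16` is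
what the criterion needs. Say that a node claims an edge if it orients it away from itself. In a
solution every node claims an edge, and no edge is claimed by both its ends.

Round elimination shows that double claims are likely for fast algorithms. The tree is the Cayley
graph of a free product of four groups of order two. Left multiplications are automorphisms that
preserve edge colours, so an algorithm is described by what the root does: by sets `C i` of
labellings in which it claims its edge of colour `i`. Suppose that the root sees radius `t + 1` and
that double claims have probability at most `q`. Orient each edge, from the common part of the views
of its ends, towards the end that is less likely to claim it (`towardRoot`). The root claims
something, so it becomes a sink with probability at most `4 * q ^ (1 / 2)`. Now let the root see
only radius `t` and claim the edge least likely to point to it (`nextColor`). Conditional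
independence in the tree and Jensen's inequality bound the new double claims by `O(q ^ (1 / 8))`. At
radius 0 the two ends are independent, and some colour is claimed doubly with probability at least
`1 / 16`. Hence the failure probability at time `T` is at least `2 ^ -O(8 ^ T)`; comparison with `1
/ n ^ c` gives `log n = O(8 ^ T)`.

Elimination needs independent identically distributed labels, but variable names encode distinct
node identifiers. Identifiers are therefore drawn uniformly below `N`; since the size of names is
unbounded, `N → ∞` for fixed `n` removes the effect of collisions. -/

/-! ### The 4-regular tree as a Cayley graph. -/

/-- Words over four letters without equal consecutive letters: the elements of the free product of
four groups of order two, and the nodes of its Cayley graph, which is the 4-regular tree. -/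
@[ext]
structure RedWord where
  toList : List (Fin 4)
  isChain : toList.IsChain (· ≠ ·)

namespace RedWord

theorem toList_injective : Function.Injective toList := fun _ _ => RedWord.ext

instance : Countable RedWord := toList_injective.countable

noncomputable instance : DecidableEq RedWord := Classical.decEq _

/-- The empty word. -/
def one : RedWord := ⟨[], List.isChain_nil⟩

/-- The number of letters of a word. -/
def len (w : RedWord) : ℕ := w.toList.length

theorem len_one : one.len = 0 := rfl

/-- Left multiplication by a letter. -/
noncomputable def lmul (i : Fin 4) (w : RedWord) : RedWord :=
  if h : w.toList.head? = some i then ⟨w.toList.tail, w.isChain.tail⟩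
  else ⟨i :: w.toList, List.isChain_cons.2 ⟨fun j hj => by rintro rfl; exact h hj, w.isChain⟩⟩

theorem lmul_toList_of_head {i : Fin 4} {w : RedWord} (h : w.toList.head? = some i) :
    w.toList = i :: (lmul i w).toList := by
  rcases w with ⟨_ | ⟨j, l⟩, hl⟩
  · simp at h
  · simp only [List.head?_cons, Option.some.injEq] at h
    subst h
    simp [lmul]

theorem lmul_toList_of_not_head {i : Fin 4} {w : RedWord} (h : w.toList.head? ≠ some i) :
    (lmul i w).toList = i :: w.toList := by
  simp [lmul, h]

theorem lmul_lmul (i : Fin 4) (w : RedWord) : lmul i (lmul i w) = w := by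
  apply RedWord.ext
  by_cases h : w.toList.head? = some i
  · have h1 := lmul_toList_of_head h
    have h2 : (lmul i w).toList.head? ≠ some i := by
      intro h3
      have := w.isChain
      rw [h1, List.isChain_cons] at this
      exact this.1 i h3 rfl
    rw [lmul_toList_of_not_head h2, ← h1]
  · have h1 := lmul_toList_of_not_head h
    have h2 : (lmul i w).toList.head? = some i := by rw [h1]; rfl
    have := lmul_toList_of_head h2
    rw [h1] at this
    exact (List.cons.inj this).2.symm

theorem len_lmul_of_head {i : Fin 4} {w : RedWord} (h : w.toList.head? = some i) :
    (lmul i w).len + 1 = w.len := by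
  rw [len, len, lmul_toList_of_head h]; rfl

theorem len_lmul_of_not_head {i : Fin 4} {w : RedWord} (h : w.toList.head? ≠ some i) :
    (lmul i w).len = w.len + 1 := by
  rw [len, len, lmul_toList_of_not_head h]; rfl

theorem len_lmul_le (i : Fin 4) (w : RedWord) : (lmul i w).len ≤ w.len + 1 := by
  by_cases h : w.toList.head? = some i
  · have := len_lmul_of_head h; omega
  · exact (len_lmul_of_not_head h).le

theorem len_lmul_ne (i : Fin 4) (w : RedWord) : (lmul i w).len ≠ w.len := by
  by_cases h : w.toList.head? = some i
  · have := len_lmul_of_head h; omega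
  · have := len_lmul_of_not_head h; omega

theorem eq_of_len_lmul_lt {i j : Fin 4} {w : RedWord} (hi : (lmul i w).len < w.len)
    (hj : (lmul j w).len < w.len) : i = j := by
  have (k : Fin 4) (hk : (lmul k w).len < w.len) : w.toList.head? = some k := by
    by_contra h
    have := len_lmul_of_not_head h
    omega
  exact Option.some.inj ((this i hi).symm.trans (this j hj))

/-- Left multiplication by a letter, as an involutive permutation. -/
noncomputable def flip (i : Fin 4) : Equiv.Perm RedWord where
  toFun := lmul i
  invFun := lmul i
  left_inv := lmul_lmul i
  right_inv := lmul_lmul i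

theorem flip_apply (i : Fin 4) (w : RedWord) : flip i w = lmul i w := rfl

/-- Left multiplication by a word, as a permutation. -/
noncomputable def trans (w : RedWord) : Equiv.Perm RedWord := (w.toList.map flip).prod

theorem trans_one : trans one = 1 := rfl

theorem trans_lmul (i : Fin 4) (w : RedWord) : trans (lmul i w) = flip i * trans w := by
  have hf : flip i * flip i = 1 := Equiv.ext (lmul_lmul i)
  by_cases h : w.toList.head? = some i
  · have h1 := lmul_toList_of_head h
    rw [trans, trans, h1, List.map_cons, List.prod_cons, ← mul_assoc, hf, one_mul]
  · rw [trans, trans, lmul_toList_of_not_head h, List.map_cons, List.prod_cons]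

/-- Arbitrary lists are allowed so that the induction need not carry reducedness. -/
theorem trans_prod_apply (l : List (Fin 4)) (w : RedWord) :
    trans ((l.map flip).prod w) = (l.map flip).prod * trans w := by
  induction l with
  | nil => rfl
  | cons i l ih =>
    simp only [List.map_cons, List.prod_cons, Equiv.Perm.mul_apply, flip_apply, trans_lmul, ih,
      mul_assoc]

theorem trans_trans (v w : RedWord) : trans (trans v w) = trans v * trans w :=
  trans_prod_apply _ _

theorem trans_apply_one (w : RedWord) : trans w one = w := by
  rcases w with ⟨l, hl⟩
  induction l with
  | nil => rfl
  | cons i l ih =>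
    have h : (⟨i :: l, hl⟩ : RedWord) = lmul i ⟨l, (List.isChain_cons.1 hl).2⟩ := by
      apply RedWord.ext
      rw [lmul_toList_of_not_head]
      intro h
      exact (List.isChain_cons.1 hl).1 i h rfl
    rw [h, trans_lmul, Equiv.Perm.mul_apply, ih, flip_apply]

/-- The neighbour of the empty word across the edge of colour `i`. -/
noncomputable def letter (i : Fin 4) : RedWord := lmul i one

theorem len_letter (i : Fin 4) : (letter i).len = 1 := by
  rw [letter, len_lmul_of_not_head (by simp [one]), len_one]

theorem letter_injective : Function.Injective letter := by
  intro i j h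
  have := congrArg (fun w : RedWord => w.toList.head?) h
  simp only [letter] at this
  rw [lmul_toList_of_not_head (by simp [one]), lmul_toList_of_not_head (by simp [one])] at this
  exact Option.some.inj this

theorem trans_letter (i : Fin 4) : trans (letter i) = flip i := by
  rw [letter, trans_lmul, trans_one, mul_one]

theorem letter_ne_one (i : Fin 4) : letter i ≠ one := fun h => by
  have := congrArg len h
  rw [len_letter, len_one] at this
  omega

/-- The neighbour of `w` across the edge of colour `i`. -/
noncomputable def nbr (w : RedWord) (i : Fin 4) : RedWord := trans w (letter i)

theorem trans_nbr (w : RedWord) (i : Fin 4) : trans (nbr w i) = trans w * flip i := by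
  rw [nbr, trans_trans, trans_letter]

theorem nbr_nbr (w : RedWord) (i : Fin 4) : nbr (nbr w i) i = w := by
  rw [nbr, trans_nbr, Equiv.Perm.mul_apply, flip_apply, letter, lmul_lmul, trans_apply_one]

theorem nbr_injective (w : RedWord) : Function.Injective (nbr w) :=
  (trans w).injective.comp letter_injective

theorem nbr_ne (w : RedWord) (i : Fin 4) : nbr w i ≠ w := fun h =>
  letter_ne_one i ((trans w).injective (h.trans (trans_apply_one w).symm))

theorem nbr_one (i : Fin 4) : nbr one i = letter i := rfl

theorem len_trans_le (v w : RedWord) : (trans v w).len ≤ v.len + w.len := by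
  rcases v with ⟨l, hl⟩
  simp only [trans, len]
  clear hl
  induction l with
  | nil => simp
  | cons i l ih =>
    have := len_lmul_le i ((l.map flip).prod w)
    simp only [len] at this
    simp only [List.map_cons, List.prod_cons, Equiv.Perm.mul_apply, flip_apply, List.length_cons]
    omega

theorem len_nbr_le (w : RedWord) (i : Fin 4) : (nbr w i).len ≤ w.len + 1 := len_trans_le _ _

/-- Every nonempty word has a neighbour that is shorter by one. -/
theorem exists_nbr_len_lt {w : RedWord} (hw : w ≠ one) : ∃ i, (nbr w i).len + 1 = w.len := by
  rcases w with ⟨l, hl⟩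
  rcases List.eq_nil_or_concat l with rfl | ⟨l', i, rfl⟩
  · exact absurd rfl hw
  · rw [List.concat_eq_append] at hl
    refine ⟨i, ?_⟩
    have hl' : l'.IsChain (· ≠ ·) := hl.left_of_append
    have key : (⟨l'.concat i, by rwa [List.concat_eq_append]⟩ : RedWord) = nbr ⟨l', hl'⟩ i := by
      have h1 := trans_apply_one ⟨l' ++ [i], hl⟩
      simp only [trans, List.map_append, List.prod_append, Equiv.Perm.mul_apply] at h1
      simp only [List.concat_eq_append]
      rw [← h1]
      rfl
    rw [key, nbr_nbr, ← key]
    simp [len]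

theorem finite_len_le (R : ℕ) : Set.Finite {w : RedWord | w.len ≤ R} :=
  (List.finite_length_le (Fin 4) R).preimage toList_injective.injOn

/-- The words of length at most `R`. -/
noncomputable def ball (R : ℕ) : Finset RedWord := (finite_len_le R).toFinset

theorem mem_ball {R : ℕ} {w : RedWord} : w ∈ ball R ↔ w.len ≤ R := by simp [ball]

theorem ball_mono {R S : ℕ} (h : R ≤ S) : ball R ⊆ ball S := fun w hw =>
  mem_ball.2 ((mem_ball.1 hw).trans h)

theorem card_ball_le (R : ℕ) : (ball R).card ≤ 5 ^ R := by
  induction R with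
  | zero =>
    rw [pow_zero, Finset.card_le_one]
    intro a ha b hb
    have (w : RedWord) (hw : w ∈ ball 0) : toList w = [] :=
      List.length_eq_zero_iff.1 (Nat.le_zero.1 (mem_ball.1 hw))
    exact RedWord.ext ((this a ha).trans (this b hb).symm)
  | succ R ih =>
    have : ball (R + 1) ⊆ ball R ∪ (ball R ×ˢ Finset.univ).image fun x => nbr x.1 x.2 := by
      intro w hw
      rw [mem_ball] at hw
      by_cases h : w.len ≤ R
      · exact Finset.mem_union_left _ (mem_ball.2 h)
      · have hw1 : w ≠ one := by rintro rfl; rw [len_one] at h; omega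
        obtain ⟨i, hi⟩ := exists_nbr_len_lt hw1
        refine Finset.mem_union_right _ (Finset.mem_image.2 ⟨(nbr w i, i), ?_, nbr_nbr w i⟩)
        rw [Finset.mem_product, mem_ball]
        exact ⟨show (nbr w i).len ≤ R by omega, Finset.mem_univ _⟩
    calc (ball (R + 1)).card ≤ _ := Finset.card_le_card this
      _ ≤ (ball R).card + ((ball R ×ˢ Finset.univ).image fun x => nbr x.1 x.2).card :=
        Finset.card_union_le _ _
      _ ≤ (ball R).card + (ball R).card * 4 := by
        gcongr
        exact Finset.card_image_le.trans (by simp)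
      _ ≤ 5 ^ (R + 1) := by rw [pow_succ]; omega

theorem lt_card_ball (R : ℕ) : R < (ball R).card := by
  have (k : ℕ) : ∃ w : RedWord, w.len = k := by
    induction k with
    | zero => exact ⟨one, rfl⟩
    | succ k ih =>
      obtain ⟨w, hw⟩ := ih
      obtain ⟨i, hi⟩ : ∃ i : Fin 4, w.toList.head? ≠ some i := by
        by_contra! h
        exact absurd (Option.some.inj ((h 0).symm.trans (h 1))) (by decide)
      exact ⟨lmul i w, by rw [len_lmul_of_not_head hi, hw]⟩
  choose g hg using this
  have h1 : Function.Injective g := fun a b h => by rw [← hg a, ← hg b, h]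
  calc R < (Finset.range (R + 1)).card := by simp
    _ = ((Finset.range (R + 1)).image g).card := (Finset.card_image_of_injective _ h1).symm
    _ ≤ _ := Finset.card_le_card fun w hw => by
      obtain ⟨k, hk, rfl⟩ := Finset.mem_image.1 hw
      rw [mem_ball, hg]
      have := Finset.mem_range.1 hk
      omega

end RedWord

/-! ### Independent labels and conditional expectation by resampling. -/

section ProductMeasure

open Measure

variable {ι Ω : Type} [MeasurableSpace Ω] (μ : Measure Ω) [IsProbabilityMeasure μ]

/-- The law of a family of independent random elements, all with law `μ`. -/
noncomputable abbrev iidMeasure (ι : Type) : Measure (ι → Ω) := infinitePi fun _ : ι => μ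

/-- A product measure is determined on products of cylinders, where both sides are finite products
over the union of the two supports. -/
theorem iidMeasure_prod_unzip :
    MeasurePreserving (fun ω : ι → Ω × Ω => ((fun w => (ω w).1), fun w => (ω w).2))
      (iidMeasure (μ.prod μ) ι) ((iidMeasure μ ι).prod (iidMeasure μ ι)) := by
  classical
  refine ⟨by fun_prop, ?_⟩
  have gen : MeasurableSpace.generateFrom
      (squareCylinders fun _ : ι => {s : Set Ω | MeasurableSet s}) = MeasurableSpace.pi :=
    generateFrom_squareCylinders
  have hpi : IsPiSystem (squareCylinders fun _ : ι => {s : Set Ω | MeasurableSet s}) :=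
    isPiSystem_squareCylinders (fun _ => MeasurableSpace.isPiSystem_measurableSet)
      fun _ => MeasurableSet.univ
  have huniv : Set.univ ∈ squareCylinders fun _ : ι => {s : Set Ω | MeasurableSet s} :=
    ⟨∅, fun _ => Set.univ, fun _ _ => MeasurableSet.univ, by simp⟩
  have fin : (iidMeasure μ ι).FiniteSpanningSetsIn
      (squareCylinders fun _ : ι => {s : Set Ω | MeasurableSet s}) :=
    ⟨fun _ => Set.univ, fun _ => huniv, fun _ => by simp, Set.iUnion_const _⟩
  refine (prod_eq_generateFrom gen gen hpi hpi fin fin ?_).symm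
  rintro _ ⟨s, a, ha, rfl⟩ _ ⟨s', b, hb, rfl⟩
  have ha' : ∀ i, MeasurableSet (a i) := fun i => ha i (Set.mem_univ i)
  have hb' : ∀ i, MeasurableSet (b i) := fun i => hb i (Set.mem_univ i)
  rw [map_apply (by fun_prop) (.prod (.pi s.countable_toSet fun i _ => ha' i)
    (.pi s'.countable_toSet fun i _ => hb' i))]
  have : (fun ω : ι → Ω × Ω => ((fun w => (ω w).1), fun w => (ω w).2)) ⁻¹'
      ((s : Set ι).pi a ×ˢ (s' : Set ι).pi b) = (↑(s ∪ s') : Set ι).pi fun i =>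
        (if i ∈ s then a i else Set.univ) ×ˢ (if i ∈ s' then b i else Set.univ) := by
    ext ω
    simp only [Set.mem_preimage, Set.mem_prod, Set.mem_pi, Finset.mem_coe, Finset.mem_union]
    constructor
    · rintro ⟨h1, h2⟩ i -
      constructor <;> split_ifs with h
      exacts [h1 i h, trivial, h2 i h, trivial]
    · intro h
      refine ⟨fun i hi => ?_, fun i hi => ?_⟩
      · simpa [hi] using (h i (Or.inl hi)).1
      · simpa [hi] using (h i (Or.inr hi)).2
  rw [this, infinitePi_pi, infinitePi_pi _ fun i _ => ha' i, infinitePi_pi _ fun i _ => hb' i]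
  · simp only [prod_prod]
    rw [Finset.prod_mul_distrib]
    congr 1
    · rw [← Finset.prod_subset (Finset.subset_union_left (s₁ := s) (s₂ := s'))]
      · exact Finset.prod_congr rfl fun i hi => by rw [if_pos hi]
      · intro i _ hi; rw [if_neg hi, measure_univ]
    · rw [← Finset.prod_subset (Finset.subset_union_right (s₁ := s) (s₂ := s'))]
      · exact Finset.prod_congr rfl fun i hi => by rw [if_pos hi]
      · intro i _ hi; rw [if_neg hi, measure_univ]
  · intro i _
    refine .prod ?_ ?_ <;> split_ifs
    exacts [ha' i, .univ, hb' i, .univ]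

variable {μ} in
/-- Combining two independent families coordinatewise. -/
theorem iidMeasure_zipWith {φ : ι → Ω × Ω → Ω}
    (hφ : ∀ w, MeasurePreserving (φ w) (μ.prod μ) μ) :
    MeasurePreserving (fun p : (ι → Ω) × (ι → Ω) => fun w => φ w (p.1 w, p.2 w))
      ((iidMeasure μ ι).prod (iidMeasure μ ι)) (iidMeasure μ ι) := by
  have hm : Measurable fun p : (ι → Ω) × (ι → Ω) => fun w => φ w (p.1 w, p.2 w) :=
    measurable_pi_lambda _ fun w => (hφ w).measurable.comp (by fun_prop)
  refine ⟨hm, ?_⟩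
  rw [← (iidMeasure_prod_unzip μ).map_eq, map_map hm (iidMeasure_prod_unzip μ).measurable]
  have := infinitePi_map_pi (fun _ : ι => μ.prod μ) fun w => (hφ w).measurable
  simp only [Function.comp_def]
  refine this.trans ?_
  congr 1
  funext w
  exact (hφ w).map_eq

theorem iidMeasure_comp_perm (e : Equiv.Perm ι) :
    MeasurePreserving (fun ω : ι → Ω => ω ∘ e) (iidMeasure μ ι) (iidMeasure μ ι) := by
  refine ⟨by fun_prop, ?_⟩
  exact map_infinitePi_infinitePi_of_inj (P := fun _ : ι => μ) e.injective


open scoped ENNReal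

open Classical in
/-- The conditional expectation of `f` given the coordinates in `S`. -/
noncomputable def condMean (S : Set ι) (f : (ι → Ω) → ℝ≥0∞) (ω : ι → Ω) : ℝ≥0∞ :=
  ∫⁻ ω', f (S.piecewise ω ω') ∂iidMeasure μ ι

variable {μ} {S A B : Set ι} {f g : (ι → Ω) → ℝ≥0∞}

open Classical in
theorem measurable_piecewise_coord (S : Set ι) :
    Measurable fun p : (ι → Ω) × (ι → Ω) => S.piecewise p.1 p.2 := by
  refine measurable_pi_lambda _ fun w => ?_
  by_cases h : w ∈ S
  · simp only [h, Set.piecewise_eq_of_mem]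
    fun_prop
  · simp only [h, not_false_eq_true, Set.piecewise_eq_of_notMem]
    fun_prop

-- Resampling the labels outside `S` leaves the law unchanged. The averaging property of `condMean`
-- is this fact combined with Fubini.
open Classical in
theorem iidMeasure_piecewise (S : Set ι) :
    MeasurePreserving (fun p : (ι → Ω) × (ι → Ω) => S.piecewise p.1 p.2)
      ((iidMeasure μ ι).prod (iidMeasure μ ι)) (iidMeasure μ ι) := by
  have := iidMeasure_zipWith (μ := μ) (φ := fun w : ι => if w ∈ S then Prod.fst else Prod.snd)
    fun w => by
      split_ifs
      exacts [measurePreserving_fst, measurePreserving_snd]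
  convert this using 1
  funext p w
  by_cases h : w ∈ S <;> simp [h]

theorem measurable_condMean (S : Set ι) (hf : Measurable f) : Measurable (condMean μ S f) :=
  (hf.comp (measurable_piecewise_coord S)).lintegral_prod_right'

theorem lintegral_condMean (S : Set ι) (hf : Measurable f) :
    ∫⁻ ω, condMean μ S f ω ∂iidMeasure μ ι = ∫⁻ ω, f ω ∂iidMeasure μ ι := by
  classical
  rw [← (iidMeasure_piecewise S).lintegral_comp hf,
    lintegral_prod (fun p => f (S.piecewise p.1 p.2))
      (hf.comp (measurable_piecewise_coord S)).aemeasurable]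
  rfl

theorem dependsOn_condMean (S : Set ι) (f : (ι → Ω) → ℝ≥0∞) : DependsOn (condMean μ S f) S := by
  classical
  intro ω₁ ω₂ h
  have : ∀ ω', S.piecewise ω₁ ω' = S.piecewise ω₂ ω' := fun ω' => by
    funext w
    by_cases hw : w ∈ S
    · simp [hw, h w hw]
    · simp [hw]
  simp only [condMean, this]

theorem condMean_mul_left (hg : DependsOn g S) (hf : Measurable f) (ω : ι → Ω) :
    condMean μ S (fun ω => g ω * f ω) ω = g ω * condMean μ S f ω := by
  classical
  have : ∀ ω', g (S.piecewise ω ω') = g ω := fun ω' => hg fun w hw => by simp [hw]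
  simp only [condMean, this]
  exact lintegral_const_mul _ (hf.comp ((measurable_piecewise_coord S).comp measurable_prodMk_left))

theorem lintegral_mul_condMean (hg : DependsOn g S) (hgm : Measurable g) (hf : Measurable f) :
    ∫⁻ ω, g ω * condMean μ S f ω ∂iidMeasure μ ι = ∫⁻ ω, g ω * f ω ∂iidMeasure μ ι := by
  refine Eq.trans ?_ (lintegral_condMean S (hgm.mul hf))
  exact lintegral_congr fun ω => (condMean_mul_left hg hf ω).symm

theorem lintegral_mul_of_dependsOn (hf : DependsOn f A) (hg : DependsOn g B) (hAB : Disjoint A B)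
    (hfm : Measurable f) (hgm : Measurable g) :
    ∫⁻ ω, f ω * g ω ∂iidMeasure μ ι =
      (∫⁻ ω, f ω ∂iidMeasure μ ι) * ∫⁻ ω, g ω ∂iidMeasure μ ι := by
  classical
  rw [← lintegral_mul_condMean hf hfm hgm, ← lintegral_mul_const _ hfm]
  refine lintegral_congr fun ω => ?_
  congr 1
  refine lintegral_congr fun ω' => hg fun w hw => ?_
  simp [Set.disjoint_right.1 hAB hw]

/-- Once the coordinates in `S` are frozen, the factors depend on `A \ S` and `B \ S`, which are
disjoint, so they are independent. -/
theorem condMean_mul (hf : DependsOn f A) (hg : DependsOn g B) (hAB : A ∩ B ⊆ S)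
    (hfm : Measurable f) (hgm : Measurable g) (ω : ι → Ω) :
    condMean μ S (fun ω => f ω * g ω) ω = condMean μ S f ω * condMean μ S g ω := by
  classical
  have key {h : (ι → Ω) → ℝ≥0∞} {D : Set ι} (hh : DependsOn h D) :
      DependsOn (fun ω' => h (S.piecewise ω ω')) (D \ S) := fun ω₁ ω₂ h12 => hh fun w hw => by
    by_cases hS : w ∈ S
    · simp [hS]
    · simpa [hS] using h12 w ⟨hw, hS⟩
  have hm : Measurable fun ω' : ι → Ω => S.piecewise ω ω' :=
    (measurable_piecewise_coord S).comp measurable_prodMk_left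
  refine lintegral_mul_of_dependsOn (key hf) (key hg) ?_ (hfm.comp hm) (hgm.comp hm)
  rw [Set.disjoint_left]
  exact fun w h1 h2 => h1.2 (hAB ⟨h1.1, h2.1⟩)

theorem condMean_prod {κ : Type} (s : Finset κ) {F : κ → (ι → Ω) → ℝ≥0∞} {A : κ → Set ι}
    (hF : ∀ k, DependsOn (F k) (A k)) (hA : ∀ k l, k ≠ l → A k ∩ A l ⊆ S)
    (hm : ∀ k, Measurable (F k)) (ω : ι → Ω) :
    condMean μ S (fun ω => ∏ k ∈ s, F k ω) ω = ∏ k ∈ s, condMean μ S (F k) ω := by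
  classical
  induction s using Finset.induction_on with
  | empty => simp [condMean]
  | insert k s hk ih =>
    simp only [Finset.prod_insert hk]
    rw [condMean_mul (hF k) (B := ⋃ l ∈ s, A l), ih]
    · exact fun ω₁ ω₂ h => Finset.prod_congr rfl fun l hl => hF l fun w hw =>
        h w (Set.mem_biUnion hl hw)
    · rw [Set.inter_iUnion₂]
      exact Set.iUnion₂_subset fun l hl => hA k l fun h => hk (h ▸ hl)
    · exact hm k
    · exact Finset.measurable_prod _ fun l _ => hm l

theorem condMean_comp_perm (e : Equiv.Perm ι) (hS : ∀ w, e w ∈ S ↔ w ∈ S) (hf : Measurable f)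
    (ω : ι → Ω) : condMean μ S (fun ω => f (ω ∘ e)) ω = condMean μ S f (ω ∘ e) := by
  classical
  have hm : Measurable fun ω' : ι → Ω => S.piecewise (ω ∘ e) ω' :=
    (measurable_piecewise_coord S).comp measurable_prodMk_left
  unfold condMean
  refine Eq.trans ?_ ((iidMeasure_comp_perm μ e).lintegral_comp (hf.comp hm))
  refine lintegral_congr fun ω' => congrArg f ?_
  funext w
  by_cases h : w ∈ S
  · simp [h, (hS w).2 h]
  · simp [h, mt (hS w).1 h]

end ProductMeasure

/-- Jensen's inequality for `x ^ k`, in the form that `L^p` norms on a probability space increase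
with `p`. -/
theorem pow_lintegral_le {α : Type} [MeasurableSpace α] {μ : Measure α} [IsProbabilityMeasure μ]
    {f : α → ENNReal} (hf : Measurable f) {k : ℕ} (hk : 1 ≤ k) :
    (∫⁻ x, f x ∂μ) ^ k ≤ ∫⁻ x, f x ^ k ∂μ := by
  have hk' : (1 : ℝ) ≤ k := by exact_mod_cast hk
  have h := eLpNorm'_le_eLpNorm'_of_exponent_le one_pos hk' μ hf.aestronglyMeasurable
  simp only [eLpNorm', enorm_eq_self, ENNReal.rpow_one, div_one, ENNReal.rpow_natCast,
    one_div] at h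
  calc (∫⁻ x, f x ∂μ) ^ k ≤ ((∫⁻ x, f x ^ k ∂μ) ^ (k : ℝ)⁻¹) ^ k := by gcongr
    _ = _ := by
      rw [← ENNReal.rpow_natCast, ← ENNReal.rpow_mul, inv_mul_cancel₀ (by positivity),
        ENNReal.rpow_one]

/-! ### Round elimination on the infinite tree. -/

section RoundElimination

open scoped ENNReal
open RedWord

variable {Ω : Type}

/-- The set of colourings in which the neighbour across the edge of colour `i`, seen as the root,
satisfies `C`. -/
def shiftSet (i : Fin 4) (C : Set (RedWord → Ω)) : Set (RedWord → Ω) := {ω | ω ∘ RedWord.flip i ∈ C}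

theorem comp_flip_comp_flip (i : Fin 4) (ω : RedWord → Ω) :
    (ω ∘ RedWord.flip i) ∘ RedWord.flip i = ω := by
  funext w
  simp [flip_apply, lmul_lmul]

/-- The words at distance at most `t` from an end of the edge of colour `i` at the root. -/
def edgeBall (t : ℕ) (i : Fin 4) : Set RedWord := {w | w.len ≤ t ∨ (lmul i w).len ≤ t}

theorem flip_mem_edgeBall {t : ℕ} {i : Fin 4} {w : RedWord} :
    RedWord.flip i w ∈ edgeBall t i ↔ w ∈ edgeBall t i := by
  simp [edgeBall, flip_apply, lmul_lmul, or_comm]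

/-- A word of `edgeBall t i` that is further than `t` from the root lies beyond the edge of colour
`i`, and only one edge at the root leads towards it. -/
theorem edgeBall_inter_edgeBall {t : ℕ} {i j : Fin 4} (h : i ≠ j) :
    edgeBall t i ∩ edgeBall t j ⊆ {w | w.len ≤ t} := by
  rintro w ⟨h1, h2⟩
  by_contra hw
  simp only [edgeBall, Set.mem_ofPred_eq] at h1 h2 hw
  exact h (eq_of_len_lmul_lt (w := w) (by omega) (by omega))

theorem dependsOn_shiftSet {C : Set (RedWord → Ω)} {t : ℕ} (i : Fin 4)
    (hC : DependsOn (fun ω => ω ∈ C) {w | w.len ≤ t}) :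
    DependsOn (fun ω => ω ∈ shiftSet i C) {w | (lmul i w).len ≤ t} := fun ω₁ ω₂ h =>
  hC fun w hw => h (lmul i w) (by simpa [lmul_lmul] using hw)

theorem DependsOn.indicator_one {C : Set (RedWord → Ω)} {S : Set RedWord}
    (hC : DependsOn (fun ω => ω ∈ C) S) :
    DependsOn (C.indicator (1 : (RedWord → Ω) → ℝ≥0∞)) S := fun ω₁ ω₂ h => by
  have := hC h
  simp only [eq_iff_iff] at this
  by_cases h1 : ω₁ ∈ C
  · simp [h1, this.1 h1]
  · simp [h1, mt this.2 h1]

variable [MeasurableSpace Ω] {μ : Measure Ω} [IsProbabilityMeasure μ]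

theorem measurable_comp_flip (i : Fin 4) :
    Measurable fun ω : RedWord → Ω => ω ∘ RedWord.flip i := by
  fun_prop

theorem measurableSet_shiftSet {C : Set (RedWord → Ω)} (i : Fin 4) (hC : MeasurableSet C) :
    MeasurableSet (shiftSet i C) := measurable_comp_flip i hC

theorem measure_shiftSet {C : Set (RedWord → Ω)} (i : Fin 4) (hC : MeasurableSet C) :
    iidMeasure μ RedWord (shiftSet i C) = iidMeasure μ RedWord C :=
  (iidMeasure_comp_perm μ (RedWord.flip i)).measure_preimage hC.nullMeasurableSet

variable (μ) in
/-- The edge of colour `i` at the root is oriented towards the root by the edge algorithm derived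
from the sets `C`, with ties allowed: given what is seen from the edge, the root is at most as
likely to claim the edge as the other end. -/
def towardRoot (C : Fin 4 → Set (RedWord → Ω)) (t : ℕ) (i : Fin 4) : Set (RedWord → Ω) :=
  {ω | condMean μ (edgeBall t i) ((C i).indicator 1) ω ≤
    condMean μ (edgeBall t i) ((C i).indicator 1) (ω ∘ RedWord.flip i)}

variable (μ) in
/-- The edge of colour `i` is the most likely to be oriented away from the root. -/
def nextColor (C : Fin 4 → Set (RedWord → Ω)) (t : ℕ) (i : Fin 4) : Set (RedWord → Ω) :=
  {ω | ∀ j, condMean μ {w | w.len ≤ t} ((towardRoot μ C t i).indicator 1) ω ≤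
    condMean μ {w | w.len ≤ t} ((towardRoot μ C t j).indicator 1) ω}

variable {C : Fin 4 → Set (RedWord → Ω)} {t : ℕ}

theorem measurable_indicator_one_set {C : Set (RedWord → Ω)} (hC : MeasurableSet C) :
    Measurable (C.indicator (1 : (RedWord → Ω) → ℝ≥0∞)) := measurable_one.indicator hC

theorem measurableSet_towardRoot (hC : ∀ i, MeasurableSet (C i)) (i : Fin 4) :
    MeasurableSet (towardRoot μ C t i) :=
  have h := measurable_condMean (μ := μ) (edgeBall t i) (measurable_indicator_one_set (hC i))
  measurableSet_le h (h.comp (measurable_comp_flip i))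

theorem measurableSet_nextColor (hC : ∀ i, MeasurableSet (C i)) (i : Fin 4) :
    MeasurableSet (nextColor μ C t i) := by
  have h (j : Fin 4) := measurable_condMean (μ := μ) {w | w.len ≤ t}
    (measurable_indicator_one_set (measurableSet_towardRoot (μ := μ) (t := t) hC j))
  simp only [nextColor, Set.ofPred_forall]
  exact MeasurableSet.iInter fun j => measurableSet_le (h i) (h j)

theorem dependsOn_towardRoot (i : Fin 4) :
    DependsOn (fun ω => ω ∈ towardRoot μ C t i) (edgeBall t i) := by
  intro ω₁ ω₂ h
  have h1 := dependsOn_condMean (μ := μ) (edgeBall t i) ((C i).indicator 1) h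
  have h2 := dependsOn_condMean (μ := μ) (edgeBall t i) ((C i).indicator 1)
    (x := ω₁ ∘ RedWord.flip i) (y := ω₂ ∘ RedWord.flip i)
    fun w hw => h _ (flip_mem_edgeBall.2 hw)
  simp only [towardRoot, Set.mem_ofPred_eq, h1, h2]

theorem dependsOn_nextColor (i : Fin 4) :
    DependsOn (fun ω => ω ∈ nextColor μ C t i) {w | w.len ≤ t} := by
  intro ω₁ ω₂ h
  have h1 (j : Fin 4) :=
    dependsOn_condMean (μ := μ) {w | w.len ≤ t} ((towardRoot μ C t j).indicator 1) h
  simp only [nextColor, Set.mem_ofPred_eq, h1]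

theorem exists_mem_nextColor (ω : RedWord → Ω) : ∃ i, ω ∈ nextColor μ C t i :=
  Finite.exists_min fun i => condMean μ {w : RedWord | w.len ≤ t} ((towardRoot μ C t i).indicator 1) ω

theorem mem_towardRoot_or (i : Fin 4) (ω : RedWord → Ω) :
    ω ∈ towardRoot μ C t i ∨ ω ∈ shiftSet i (towardRoot μ C t i) := by
  simp only [towardRoot, shiftSet, Set.mem_ofPred_eq, comp_flip_comp_flip]
  exact le_total _ _

theorem indicator_one_mul_indicator_one {α : Type} (A B : Set α) (x : α) :
    A.indicator (1 : α → ℝ≥0∞) x * B.indicator (1 : α → ℝ≥0∞) x =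
      (A ∩ B).indicator (1 : α → ℝ≥0∞) x := by
  by_cases h1 : x ∈ A <;> by_cases h2 : x ∈ B <;> simp [h1, h2]

/-- Let `r` be the conditional probability of `C i` given the view `S` of the edge. The balls of
radius `t + 1` around the two ends meet inside `S`, so given `S` the claims of the ends are
independent and a double claim has probability `r ω * r (ω ∘ flip i)`. Where the edge points to the
root this is at least `r ω ^ 2`, and Jensen's inequality finishes. -/
theorem sq_measure_towardRoot_inter_le (hC : ∀ i, MeasurableSet (C i))
    (hdep : ∀ i, DependsOn (fun ω => ω ∈ C i) {w | w.len ≤ t + 1}) (i : Fin 4) :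
    iidMeasure μ RedWord (towardRoot μ C t i ∩ C i) ^ 2 ≤
      iidMeasure μ RedWord (C i ∩ shiftSet i (C i)) := by
  set P := iidMeasure μ RedWord
  set S := edgeBall t i
  set r := condMean μ S ((C i).indicator 1)
  have hD := measurableSet_towardRoot (μ := μ) (t := t) hC i
  have hDm := measurable_indicator_one_set hD
  have hCm := measurable_indicator_one_set (hC i)
  have hsm := measurable_indicator_one_set (measurableSet_shiftSet i (hC i))
  have hrm : Measurable r := measurable_condMean S hCm
  have h1 : P (towardRoot μ C t i ∩ C i) =
      ∫⁻ ω, (towardRoot μ C t i).indicator 1 ω * r ω ∂P := by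
    rw [lintegral_mul_condMean (dependsOn_towardRoot i).indicator_one hDm hCm,
      ← lintegral_indicator_one (hD.inter (hC i))]
    exact lintegral_congr fun ω => (indicator_one_mul_indicator_one _ _ _).symm
  have h2 : P (C i ∩ shiftSet i (C i)) = ∫⁻ ω, r ω * r (ω ∘ RedWord.flip i) ∂P := by
    rw [← lintegral_indicator_one ((hC i).inter (measurableSet_shiftSet i (hC i))),
      ← lintegral_condMean S (measurable_indicator_one_set
        ((hC i).inter (measurableSet_shiftSet i (hC i))))]
    refine lintegral_congr fun ω => ?_
    have hs := condMean_comp_perm (μ := μ) (RedWord.flip i) (S := S)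
      (fun w => flip_mem_edgeBall) hCm ω
    refine Eq.trans ?_ ((condMean_mul (hdep i).indicator_one
      (dependsOn_shiftSet i (hdep i)).indicator_one ?_ hCm hsm ω).trans (congrArg (r ω * ·) hs))
    · congr 1
      funext ω
      exact (indicator_one_mul_indicator_one _ _ _).symm
    · rintro w ⟨hw1, hw2⟩
      -- The two ends are never equally far from `w`; if both distances are at most `t + 1`, the
      -- smaller is at most `t`.
      have := len_lmul_ne i w
      simp only [Set.mem_ofPred_eq, S, edgeBall] at hw1 hw2 ⊢
      omega
  rw [h1, h2]
  refine (pow_lintegral_le (hDm.mul hrm) one_le_two).trans (lintegral_mono fun ω => ?_)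
  by_cases h : ω ∈ towardRoot μ C t i
  · simp only [Pi.mul_apply, Set.indicator_of_mem h, Pi.one_apply, one_mul, pow_two]
    exact mul_le_mul_right h _
  · simp [h]

/-- By `hcov` a sink claims some edge, and that edge points to it; the union bound over four colours
costs the factor `4 ^ 2`. -/
theorem measure_iInter_towardRoot_le (hC : ∀ i, MeasurableSet (C i)) (hcov : ∀ ω, ∃ i, ω ∈ C i)
    (hdep : ∀ i, DependsOn (fun ω => ω ∈ C i) {w | w.len ≤ t + 1}) {q : ℝ≥0∞}
    (hq : ∀ i, iidMeasure μ RedWord (C i ∩ shiftSet i (C i)) ≤ q) :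
    iidMeasure μ RedWord (⋂ i, towardRoot μ C t i) ^ 2 ≤ 16 * q := by
  set P := iidMeasure μ RedWord
  obtain ⟨i, hi⟩ := Finite.exists_max fun i => P (towardRoot μ C t i ∩ C i)
  have : P (⋂ i, towardRoot μ C t i) ≤ 4 * P (towardRoot μ C t i ∩ C i) := by
    calc P (⋂ i, towardRoot μ C t i) ≤ P (⋃ i, towardRoot μ C t i ∩ C i) := by
          refine measure_mono fun ω hω => ?_
          obtain ⟨j, hj⟩ := hcov ω
          exact Set.mem_iUnion.2 ⟨j, Set.mem_iInter.1 hω j, hj⟩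
      _ ≤ ∑ j, P (towardRoot μ C t j ∩ C j) := measure_iUnion_fintype_le _ _
      _ ≤ ∑ _j : Fin 4, P (towardRoot μ C t i ∩ C i) := Finset.sum_le_sum fun j _ => hi j
      _ = _ := by simp
  calc P (⋂ i, towardRoot μ C t i) ^ 2 ≤ (4 * P (towardRoot μ C t i ∩ C i)) ^ 2 := by gcongr
    _ = 16 * P (towardRoot μ C t i ∩ C i) ^ 2 := by ring
    _ ≤ 16 * q := by
      gcongr
      exact (sq_measure_towardRoot_inter_le hC hdep i).trans (hq i)

/-- Given the ball of radius `t`, the four orientations at the root are independent, since the edge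
views meet only inside this ball. The chosen colour minimises the conditional probability `r i`, so
`r i ^ 4` is at most the conditional probability of a sink. -/
theorem pow_measure_nextColor_inter_le (hC : ∀ i, MeasurableSet (C i)) (i : Fin 4) :
    iidMeasure μ RedWord (nextColor μ C t i ∩ towardRoot μ C t i) ^ 4 ≤
      iidMeasure μ RedWord (⋂ i, towardRoot μ C t i) := by
  set P := iidMeasure μ RedWord
  set S : Set RedWord := {w | w.len ≤ t}
  set r := fun i => condMean μ S ((towardRoot μ C t i).indicator 1)
  have hD (i) := measurableSet_towardRoot (μ := μ) (t := t) hC i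
  have hDm (i) := measurable_indicator_one_set (hD i)
  have hN := measurableSet_nextColor (μ := μ) (t := t) hC i
  have hNm := measurable_indicator_one_set hN
  have hrm : Measurable (r i) := measurable_condMean S (hDm i)
  have h1 : P (nextColor μ C t i ∩ towardRoot μ C t i) =
      ∫⁻ ω, (nextColor μ C t i).indicator 1 ω * r i ω ∂P := by
    rw [lintegral_mul_condMean (dependsOn_nextColor i).indicator_one hNm (hDm i),
      ← lintegral_indicator_one (hN.inter (hD i))]
    exact lintegral_congr fun ω => (indicator_one_mul_indicator_one _ _ _).symm
  have h2 : P (⋂ i, towardRoot μ C t i) = ∫⁻ ω, ∏ i, r i ω ∂P := by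
    have hI := MeasurableSet.iInter hD
    rw [← lintegral_indicator_one hI, ← lintegral_condMean S (measurable_indicator_one_set hI)]
    refine lintegral_congr fun ω => ?_
    rw [← condMean_prod Finset.univ (fun k => (dependsOn_towardRoot k).indicator_one)
      (fun k l hkl => edgeBall_inter_edgeBall hkl) hDm ω]
    congr 1
    funext ω
    by_cases h : ∀ k, ω ∈ towardRoot μ C t k
    · rw [Set.indicator_of_mem (Set.mem_iInter.2 h), Finset.prod_eq_one]
      · rfl
      · exact fun k _ => by rw [Set.indicator_of_mem (h k)]; rfl
    · rw [Set.indicator_of_notMem (mt Set.mem_iInter.1 h)]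
      push Not at h
      obtain ⟨k, hk⟩ := h
      exact (Finset.prod_eq_zero (Finset.mem_univ k) (Set.indicator_of_notMem hk _)).symm
  rw [h1, h2]
  refine (pow_lintegral_le (hNm.mul hrm) (by norm_num)).trans (lintegral_mono fun ω => ?_)
  by_cases h : ω ∈ nextColor μ C t i
  · simp only [Pi.mul_apply, Set.indicator_of_mem h, Pi.one_apply, one_mul]
    calc r i ω ^ 4 = ∏ _j : Fin 4, r i ω := by simp
      _ ≤ _ := Finset.prod_le_prod' fun j _ => h j
  · simp [h]

/-- Elimination of one round: if no edge is claimed by both ends, up to probability `q`, then the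
same holds for the derived algorithm that sees one step less, up to probability `O(q ^ (1 / 8))`. -/
theorem pow_measure_nextColor_inter_shiftSet_le (hC : ∀ i, MeasurableSet (C i))
    (hcov : ∀ ω, ∃ i, ω ∈ C i)
    (hdep : ∀ i, DependsOn (fun ω => ω ∈ C i) {w | w.len ≤ t + 1}) {q : ℝ≥0∞}
    (hq : ∀ i, iidMeasure μ RedWord (C i ∩ shiftSet i (C i)) ≤ q) (i : Fin 4) :
    iidMeasure μ RedWord (nextColor μ C t i ∩ shiftSet i (nextColor μ C t i)) ^ 8 ≤
      2 ^ 12 * q := by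
  set P := iidMeasure μ RedWord
  set N := nextColor μ C t i
  set D := towardRoot μ C t i
  have hm : MeasurableSet (N ∩ D) :=
    (measurableSet_nextColor hC i).inter (measurableSet_towardRoot hC i)
  have h1 : P (N ∩ shiftSet i N) ≤ 2 * P (N ∩ D) := by
    -- The edge points to at least one of its ends, and that end has chosen it.
    calc P (N ∩ shiftSet i N) ≤ P ((N ∩ D) ∪ shiftSet i (N ∩ D)) := by
          refine measure_mono fun ω hω => ?_
          rcases mem_towardRoot_or (μ := μ) (C := C) (t := t) i ω with h | h
          · exact Or.inl ⟨hω.1, h⟩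
          · exact Or.inr ⟨hω.2, h⟩
      _ ≤ P (N ∩ D) + P (shiftSet i (N ∩ D)) := measure_union_le _ _
      _ = _ := by rw [measure_shiftSet i hm, two_mul]
  calc P (N ∩ shiftSet i N) ^ 8 ≤ (2 * P (N ∩ D)) ^ 8 := by gcongr
    _ = 2 ^ 8 * (P (N ∩ D) ^ 4) ^ 2 := by ring
    _ ≤ 2 ^ 8 * P (⋂ i, towardRoot μ C t i) ^ 2 := by
      gcongr
      exact pow_measure_nextColor_inter_le hC i
    _ ≤ 2 ^ 8 * (16 * q) := by
      gcongr
      exact measure_iInter_towardRoot_le hC hcov hdep hq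
    _ = 2 ^ 12 * q := by rw [← mul_assoc]; norm_num

/-- The ends of an edge use disjoint labels, so a double claim has the squared probability of a
claim; the likeliest colour has probability at least `1 / 4`. -/
theorem exists_le_measure_of_dependsOn_root (hC : ∀ i, MeasurableSet (C i))
    (hcov : ∀ ω, ∃ i, ω ∈ C i) (hdep : ∀ i, DependsOn (fun ω => ω ∈ C i) {w | w.len ≤ 0}) :
    ∃ i, (2⁻¹ : ℝ≥0∞) ^ 4 ≤ iidMeasure μ RedWord (C i ∩ shiftSet i (C i)) := by
  set P := iidMeasure μ RedWord
  obtain ⟨i, hi⟩ := Finite.exists_max fun i => P (C i)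
  refine ⟨i, ?_⟩
  have h4 : 1 ≤ 4 * P (C i) := by
    calc 1 = P Set.univ := measure_univ.symm
      _ ≤ P (⋃ i, C i) := measure_mono fun ω _ => Set.mem_iUnion.2 (hcov ω)
      _ ≤ ∑ j, P (C j) := measure_iUnion_fintype_le _ _
      _ ≤ ∑ _j : Fin 4, P (C i) := Finset.sum_le_sum fun j _ => hi j
      _ = _ := by simp
  have hs := measurableSet_shiftSet i (hC i)
  have h2 : P (C i ∩ shiftSet i (C i)) = P (C i) * P (C i) := by
    have h := lintegral_mul_of_dependsOn (μ := μ) (hdep i).indicator_one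
      (dependsOn_shiftSet i (hdep i)).indicator_one
      (Set.disjoint_left.2 fun w (h1 : w.len ≤ 0) (h2 : (lmul i w).len ≤ 0) =>
        len_lmul_ne i w (by omega))
      (measurable_indicator_one_set (hC i)) (measurable_indicator_one_set hs)
    simp only [indicator_one_mul_indicator_one] at h
    rw [lintegral_indicator_one ((hC i).inter hs), lintegral_indicator_one (hC i),
      lintegral_indicator_one hs, measure_shiftSet i (hC i)] at h
    exact h
  rw [h2]
  have h5 : (4 : ℝ≥0∞)⁻¹ ≤ P (C i) := by
    rw [ENNReal.inv_le_iff_le_mul] <;> simp [h4]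
  calc (2⁻¹ : ℝ≥0∞) ^ 4 = 4⁻¹ * 4⁻¹ := by
        rw [show (4 : ℝ≥0∞) = 2 ^ 2 by norm_num, ENNReal.inv_pow]; ring
    _ ≤ _ := mul_le_mul' h5 h5

/-- In a randomised algorithm that sees the labels up to distance `t` in the 4-regular tree, and in
which every node claims an edge, some edge is claimed by both ends with probability at least
`2 ^ -O(8 ^ t)`. -/
theorem exists_le_measure_inter_shiftSet (t : ℕ) : ∀ {C : Fin 4 → Set (RedWord → Ω)},
    (∀ i, MeasurableSet (C i)) → (∀ ω, ∃ i, ω ∈ C i) →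
    (∀ i, DependsOn (fun ω => ω ∈ C i) {w | w.len ≤ t}) →
    ∃ i, (2⁻¹ : ℝ≥0∞) ^ (6 * 8 ^ t - 2) ≤ iidMeasure μ RedWord (C i ∩ shiftSet i (C i)) := by
  induction t with
  | zero => exact fun hC hcov hdep => exists_le_measure_of_dependsOn_root hC hcov hdep
  | succ t ih =>
    intro C hC hcov hdep
    obtain ⟨j, hj⟩ := ih (C := nextColor μ C t) (measurableSet_nextColor hC) exists_mem_nextColor
      dependsOn_nextColor
    obtain ⟨i, hi⟩ := Finite.exists_max fun i => iidMeasure μ RedWord (C i ∩ shiftSet i (C i))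
    refine ⟨i, ?_⟩
    have h := pow_measure_nextColor_inter_shiftSet_le hC hcov hdep hi j
    set q := iidMeasure μ RedWord (C i ∩ shiftSet i (C i))
    have h8 : 1 ≤ 8 ^ t := Nat.one_le_pow _ _ (by norm_num)
    -- One elimination turns an exponent `a` into `8 * a + 12`; the sequence `6 * 8 ^ t - 2` starts
    -- at 4 and grows at least as fast.
    calc (2⁻¹ : ℝ≥0∞) ^ (6 * 8 ^ (t + 1) - 2) ≤ 2⁻¹ ^ (12 + (6 * 8 ^ t - 2) * 8) := by
          refine pow_le_pow_right_of_le_one' (by simp) ?_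
          rw [pow_succ]
          omega
      _ = 2⁻¹ ^ 12 * (2⁻¹ ^ (6 * 8 ^ t - 2)) ^ 8 := by rw [pow_add, pow_mul]
      _ ≤ 2⁻¹ ^ 12 * (2 ^ 12 * q) := by
        gcongr
        exact (pow_le_pow_left' hj 8).trans h
      _ = q := by
        rw [← mul_assoc, ← mul_pow, ENNReal.inv_mul_cancel (by simp) (by simp), one_pow, one_mul]

end RoundElimination

/-! ### Sinkless orientation as an instance of the local lemma. -/

section SinklessOrientation

open RedWord

/-- The name of the variable shared by the nodes with identifiers `a` and `b`. -/
def edgeName (a b : ℕ) : ℕ := Nat.pair (min a b) (max a b)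

theorem edgeName_comm (a b : ℕ) : edgeName a b = edgeName b a := by
  rw [edgeName, edgeName, min_comm, max_comm]

theorem edgeName_eq {a b a' b' : ℕ} (h : edgeName a b = edgeName a' b') :
    (a = a' ∧ b = b') ∨ (a = b' ∧ b = a') := by
  rw [edgeName, edgeName, Nat.pair_eq_pair] at h
  omega

theorem edgeName_right_injective (a : ℕ) : Function.Injective (edgeName a) := fun b b' h => by
  have := edgeName_eq h
  omega

/-- The value of the variable named `X` which means that the edge points to the node with
identifier `a`, if this is one of its ends. -/
def pointTo (a X : ℕ) : ℕ := if X.unpair.2 = a then 1 else 0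

theorem pointTo_edgeName {a b : ℕ} (h : a ≠ b) {y : ℕ} (hy : y = 0 ∨ y = 1) :
    y = pointTo a (edgeName a b) ∨ y = pointTo b (edgeName a b) := by
  simp only [pointTo, edgeName, Nat.unpair_pair]
  split_ifs <;> omega

/-- The law of a fair coin. -/
noncomputable def fairCoin : PMF ℕ := PMF.uniformOfFinset {0, 1} (Finset.insert_nonempty 0 {1})

theorem mem_support_fairCoin {y : ℕ} : y ∈ fairCoin.support ↔ y = 0 ∨ y = 1 := by
  simp [fairCoin]

theorem fairCoin_apply {y : ℕ} (hy : y = 0 ∨ y = 1) : fairCoin y = 2⁻¹ := by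
  rw [fairCoin, PMF.uniformOfFinset_apply_of_mem]
  · simp
  · simpa using hy

theorem pointTo_eq_zero_or (a X : ℕ) : pointTo a X = 0 ∨ pointTo a X = 1 := by
  unfold pointTo; split_ifs <;> simp

/-- The names of the variables at a node with identifier `a` whose neighbours have identifiers
`b`. -/
def edgeNames (a : ℕ) (b : Fin 4 → ℕ) : Finset ℕ := Finset.univ.image fun j => edgeName a (b j)

theorem mem_edgeNames {a : ℕ} {b : Fin 4 → ℕ} {X : ℕ} :
    X ∈ edgeNames a b ↔ ∃ j, edgeName a (b j) = X := by simp [edgeNames]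

theorem card_edgeNames (a : ℕ) {b : Fin 4 → ℕ} (hb : Function.Injective b) :
    (edgeNames a b).card = 4 := by
  rw [edgeNames, Finset.card_image_of_injective _ (f := fun j => edgeName a (b j))
    ((edgeName_right_injective a).comp hb)]
  simp

/-- The local input of a node in the sinkless orientation problem. -/
noncomputable def sinkInput (deg a : ℕ) (b : Fin 4 → ℕ) : LocalInput where
  degree := deg
  vbl := edgeNames a b
  law := fun _ => fairCoin
  bad := {g | ∀ X, g X = pointTo a X}

variable {n : ℕ}

/-- The sinkless orientation problem on the nodes `e v` of the 4-regular tree, with identifiers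
`ident`. Edges with only one end among these nodes are kept as variables. -/
noncomputable def sinkInstance (e : Fin n → RedWord) (ident : RedWord → ℕ) : LLLInstance n where
  law := fun _ => fairCoin
  finite_range := fun _ => (Set.toFinite {0, 1}).subset fun _ hy => mem_support_fairCoin.1 hy
  vbl v := edgeNames (ident (e v)) fun j => ident (nbr (e v) j)
  bad v := {g | ∀ X, g X = pointTo (ident (e v)) X}
  depends v X := by
    classical
    -- The only bad assignment points every edge to `v`; reversing the single edge `X` leaves it.
    refine ⟨fun Y => pointTo (ident (e v)) Y,
      Function.update (fun Y => pointTo (ident (e v)) Y) X (1 - pointTo (ident (e v)) X),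
      fun Y => mem_support_fairCoin.2 (pointTo_eq_zero_or _ _), fun Y => ?_, fun Y hY => ?_,
      fun Y => rfl, fun h => ?_⟩
    · refine mem_support_fairCoin.2 ?_
      rcases eq_or_ne Y X with rfl | hY
      · rw [Function.update_self]; omega
      · rw [Function.update_of_ne hY]; exact pointTo_eq_zero_or _ _
    · rw [Function.update_of_ne hY]
    · have h1 := h X
      rw [Function.update_self] at h1
      have := pointTo_eq_zero_or (ident (e v)) X
      omega

section Instance

variable {e : Fin n → RedWord} {ident : RedWord → ℕ}

theorem localInput_sinkInstance (v : Fin n) :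
    (sinkInstance e ident).localInput v = sinkInput ((sinkInstance e ident).depGraph.degree v)
      (ident (e v)) fun j => ident (nbr (e v) j) := rfl

/-- Edges that leave the finite tree remain variables, so boundary nodes too have four coins, and
exactly one of the 16 outcomes is bad. -/
theorem prob_sinkInstance (hid : Function.Injective ident) (v : Fin n) :
    (sinkInstance e ident).prob v = 1 / 16 := by
  have hs : (sinkInstance e ident).bad v =
      {fun X : (sinkInstance e ident).vbl v => pointTo (ident (e v)) X} := by
    ext g
    exact ⟨fun h => funext h, fun h X => congrFun h X⟩
  rw [LLLInstance.prob, hs, Measure.real, Measure.pi_singleton]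
  have h1 (X : (sinkInstance e ident).vbl v) :
      ((sinkInstance e ident).law X).toMeasure {pointTo (ident (e v)) X} = 2⁻¹ := by
    rw [PMF.toMeasure_apply_singleton _ _ (measurableSet_singleton _)]
    exact fairCoin_apply (pointTo_eq_zero_or _ _)
  simp only [h1, Finset.prod_const, Finset.card_univ, Fintype.card_coe]
  have : ((sinkInstance e ident).vbl v).card = 4 :=
    card_edgeNames _ (hid.comp (nbr_injective (e v)))
  rw [this]
  simp only [ENNReal.toReal_pow, ENNReal.toReal_inv, ENNReal.toReal_ofNat]
  norm_num

theorem adj_sinkInstance (he : Function.Injective e) (hid : Function.Injective ident)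
    {u v : Fin n} : (sinkInstance e ident).depGraph.Adj u v ↔ ∃ i, e v = nbr (e u) i := by
  constructor
  · rintro ⟨huv, h⟩
    obtain ⟨X, hX, hX'⟩ := Finset.not_disjoint_iff.1 h
    obtain ⟨i, hi⟩ := mem_edgeNames.1 hX
    obtain ⟨j, hj⟩ := mem_edgeNames.1 hX'
    rcases edgeName_eq (hi.trans hj.symm) with ⟨h1, -⟩ | ⟨-, h2⟩
    · exact absurd (he (hid h1)) huv
    · exact ⟨i, (hid h2).symm⟩
  · rintro ⟨i, hi⟩
    refine ⟨?_, Finset.not_disjoint_iff.2 ⟨edgeName (ident (e u)) (ident (e v)),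
      mem_edgeNames.2 ⟨i, by rw [hi]⟩, mem_edgeNames.2 ⟨i, ?_⟩⟩⟩
    · rintro rfl
      exact nbr_ne _ _ hi.symm
    · rw [edgeName_comm, hi, nbr_nbr]

variable {R : ℕ} (he : Function.Injective e) (hid : Function.Injective ident)
  (hball : ∀ w : RedWord, w.len ≤ R → w ∈ Set.range e)

include he hid in
theorem degree_sinkInstance_le (v : Fin n) : (sinkInstance e ident).depGraph.degree v ≤ 4 := by
  calc (sinkInstance e ident).depGraph.degree v
      = (((sinkInstance e ident).depGraph.neighborFinset v).image e).card :=
        (Finset.card_image_of_injective _ he).symm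
    _ ≤ (Finset.univ.image (nbr (e v))).card := by
        refine Finset.card_le_card fun w hw => ?_
        obtain ⟨u, hu, rfl⟩ := Finset.mem_image.1 hw
        rw [SimpleGraph.mem_neighborFinset, adj_sinkInstance he hid] at hu
        obtain ⟨i, hi⟩ := hu
        exact Finset.mem_image.2 ⟨i, Finset.mem_univ _, hi.symm⟩
    _ ≤ 4 := Finset.card_image_le.trans (by simp)

include he hid hball in
theorem degree_sinkInstance {v : Fin n} (hv : (e v).len + 1 ≤ R) :
    (sinkInstance e ident).depGraph.degree v = 4 := by
  refine le_antisymm (degree_sinkInstance_le he hid v) ?_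
  calc 4 = (Finset.univ.image (nbr (e v))).card := by
        rw [Finset.card_image_of_injective _ (nbr_injective _)]; simp
    _ ≤ (((sinkInstance e ident).depGraph.neighborFinset v).image e).card := by
        refine Finset.card_le_card fun w hw => ?_
        obtain ⟨i, -, rfl⟩ := Finset.mem_image.1 hw
        obtain ⟨u, hu⟩ := hball (nbr (e v) i) ((len_nbr_le _ _).trans hv)
        refine Finset.mem_image.2 ⟨u, ?_, hu⟩
        rw [SimpleGraph.mem_neighborFinset, adj_sinkInstance he hid]
        exact ⟨i, hu⟩
    _ = _ := Finset.card_image_of_injective _ he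

include he hid hball in
theorem maxDegree_sinkInstance (hR : 1 ≤ R) : (sinkInstance e ident).depGraph.maxDegree = 4 := by
  obtain ⟨v, hv⟩ := hball one (by rw [len_one]; omega)
  refine le_antisymm
    (SimpleGraph.maxDegree_le_of_forall_degree_le _ _ (degree_sinkInstance_le he hid)) ?_
  rw [← degree_sinkInstance he hid hball (v := v) (by rw [hv, len_one]; omega)]
  exact SimpleGraph.degree_le_maxDegree _ v

-- Induction on the distance to the root: the shorter neighbour of a node has length at most `R`, so
-- it is again a node.
include he hid hball in
theorem connected_sinkInstance (hR : ∀ v, (e v).len ≤ R + 1) :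
    (sinkInstance e ident).depGraph.Connected := by
  obtain ⟨r, hr⟩ := hball one (by rw [len_one]; omega)
  have key (k : ℕ) : ∀ v, (e v).len = k → (sinkInstance e ident).depGraph.Reachable v r := by
    induction k with
    | zero =>
      intro v hv
      have h1 : e v = one := RedWord.ext (List.length_eq_zero_iff.1 hv)
      rw [he (h1.trans hr.symm)]
    | succ k ih =>
      intro v hv
      obtain ⟨i, hi⟩ := exists_nbr_len_lt (w := e v) (fun h => by rw [h, len_one] at hv; omega)
      have := hR v
      obtain ⟨u, hu⟩ := hball (nbr (e v) i) (by omega)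
      have hadj : (sinkInstance e ident).depGraph.Adj v u :=
        (adj_sinkInstance he hid).2 ⟨i, hu⟩
      exact hadj.reachable.trans (ih u (by rw [hu]; omega))
  exact { preconnected := fun u v => (key _ u rfl).trans (key _ v rfl).symm, nonempty := ⟨r⟩ }

-- Ports equal colours away from the boundary, so that port numbers carry no information beyond the
-- symmetric tree; elsewhere any numbering will do.
include he hid hball in
theorem exists_portNumbering : ∃ P : (sinkInstance e ident).PortNumbering,
    ∀ v, (e v).len + 1 ≤ R → ∀ (i : Fin ((sinkInstance e ident).depGraph.degree v)) (j : Fin 4),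
      i.val = j.val → e (P v i) = nbr (e v) j := by
  have key (v : Fin n) : ∃ p : Fin ((sinkInstance e ident).depGraph.degree v) ≃
      (sinkInstance e ident).depGraph.neighborSet v, (e v).len + 1 ≤ R →
        ∀ (i : Fin ((sinkInstance e ident).depGraph.degree v)) (j : Fin 4),
          i.val = j.val → e (p i) = nbr (e v) j := by
    by_cases hv : (e v).len + 1 ≤ R
    · have hd := degree_sinkInstance he hid hball hv
      choose g hg using fun j => hball (nbr (e v) j) ((len_nbr_le _ _).trans hv)
      let p : Fin 4 → (sinkInstance e ident).depGraph.neighborSet v :=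
        fun j => ⟨g j, (adj_sinkInstance he hid).2 ⟨j, hg j⟩⟩
      have hp : Function.Bijective p := by
        constructor
        · intro i j h
          apply nbr_injective (e v)
          rw [← hg i, ← hg j]
          exact congrArg (fun u => e u.1) h
        · rintro ⟨u, hu⟩
          obtain ⟨i, hi⟩ := (adj_sinkInstance he hid).1 hu
          exact ⟨i, Subtype.ext (he ((hg i).trans hi.symm))⟩
      refine ⟨(finCongr hd).trans (Equiv.ofBijective p hp), fun _ i j hij => ?_⟩
      have : finCongr hd i = j := Fin.ext hij
      rw [Equiv.trans_apply, this]
      exact hg j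
    · exact ⟨(Fintype.equivFinOfCardEq (SimpleGraph.card_neighborSet_eq_degree _ _)).symm,
        fun h => absurd h hv⟩
  choose P hP using key
  exact ⟨P, hP⟩

end Instance

/-! ### Running the algorithm on the infinite tree. -/

namespace LocalAlgorithm

variable (A : LocalAlgorithm)

/-- The state after `s` rounds of the root of the infinite 4-regular tree, when the nodes have
random numbers `x` and identifiers `ident`. -/
noncomputable def treeState (n : ℕ) :
    ℕ → (RedWord → unitInterval) → (RedWord → ℕ) → A.State
  | 0, x, ident => A.init n 4 (sinkInput 4 (ident one) fun j => ident (letter j)) (x one)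
  | s + 1, x, ident => A.receive (treeState n s x ident) <| List.ofFn fun i : Fin 4 =>
      A.send (treeState n s (x ∘ RedWord.flip i) (ident ∘ RedWord.flip i)) i

/-- The radius is `s + 1` and not `s` because the names of its variables already show a node the
identifiers of its neighbours. -/
theorem treeState_congr (s : ℕ) : ∀ {x x' : RedWord → unitInterval} {ident ident' : RedWord → ℕ},
    (∀ w, len w ≤ s + 1 → x w = x' w) → (∀ w, len w ≤ s + 1 → ident w = ident' w) →
    A.treeState n s x ident = A.treeState n s x' ident' := by
  induction s with
  | zero =>
    intro x x' ident ident' hx hid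
    have h1 : one.len ≤ 0 + 1 := by rw [len_one]; omega
    have h2 (j) : (letter j).len ≤ 0 + 1 := (len_letter j).le
    simp only [treeState, hx _ h1, hid _ h1, hid _ (h2 _)]
  | succ s ih =>
    intro x x' ident ident' hx hid
    have hi (i : Fin 4) := ih (x := x ∘ RedWord.flip i) (x' := x' ∘ RedWord.flip i)
      (ident := ident ∘ RedWord.flip i) (ident' := ident' ∘ RedWord.flip i)
      (fun w hw => hx _ ((len_lmul_le i w).trans (by omega)))
      (fun w hw => hid _ ((len_lmul_le i w).trans (by omega)))
    simp only [treeState, hi, ih (fun w hw => hx w (by omega)) (fun w hw => hid w (by omega))]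

variable {e : Fin n → RedWord} {ident : RedWord → ℕ} {R : ℕ}

/-- In `s` rounds only nodes at distance at most `s` matter, and by the bound on `R` these have all
four neighbours. Left multiplication by `e v` moves the root to `v` and preserves colours. -/
theorem stateAfter_eq_treeState (he : Function.Injective e) (hid : Function.Injective ident)
    (hball : ∀ w : RedWord, w.len ≤ R → w ∈ Set.range e)
    {P : (sinkInstance e ident).PortNumbering}
    (hP : ∀ v, (e v).len + 1 ≤ R →
      ∀ (i : Fin ((sinkInstance e ident).depGraph.degree v)) (j : Fin 4),
        i.val = j.val → e (P v i) = nbr (e v) j)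
    (x : RedWord → unitInterval) (s : ℕ) : ∀ v, (e v).len + s + 1 ≤ R →
    A.stateAfter (sinkInstance e ident) P (x ∘ e) s v =
      A.treeState n s (x ∘ trans (e v)) (ident ∘ trans (e v)) := by
  induction s with
  | zero =>
    intro v hv
    rw [stateAfter, localInput_sinkInstance, degree_sinkInstance he hid hball (by omega),
      maxDegree_sinkInstance he hid hball (by omega), treeState]
    simp only [Function.comp_apply, trans_apply_one]
    rfl
  | succ s ih =>
    intro v hv
    have hd := degree_sinkInstance he hid hball (v := v) (by omega)
    rw [stateAfter, treeState, ih v (by omega), List.ofFn_congr hd]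
    congr 2
    funext j
    set i := Fin.cast hd.symm j
    have hi : e (P v i) = nbr (e v) j := hP v (by omega) i j rfl
    have hlen : (e (P v i)).len ≤ (e v).len + 1 := hi ▸ len_nbr_le _ _
    -- Both ends number their common edge by its colour, so the message comes through port `j` of
    -- the neighbour.
    have hback : ((P (P v i)).symm
        ⟨v, (sinkInstance e ident).depGraph.adj_symm (P v i).2⟩).val = j.val := by
      have hd' := degree_sinkInstance he hid hball (v := (P v i).1) (by omega)
      have h1 := hP (P v i) (by omega) (Fin.cast hd'.symm j) j rfl
      rw [hi, nbr_nbr] at h1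
      have h2 : P (P v i) (Fin.cast hd'.symm j) =
          ⟨v, (sinkInstance e ident).depGraph.adj_symm (P v i).2⟩ := Subtype.ext (he h1)
      rw [← h2, Equiv.symm_apply_apply]
      rfl
    rw [hback, ih (P v i) (by omega), hi, trans_nbr]
    rfl

/-- The edge of colour `i` at the root of the tree is oriented away from the root by the output
of the root. -/
def ClaimsEdge (n t : ℕ) (i : Fin 4) (x : RedWord → unitInterval) (ident : RedWord → ℕ) : Prop :=
  A.output (A.treeState n t x ident) (edgeName (ident one) (ident (letter i))) ≠
    pointTo (ident one) (edgeName (ident one) (ident (letter i)))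

theorem claimsEdge_congr {t : ℕ} (i : Fin 4) {x x' : RedWord → unitInterval}
    {ident ident' : RedWord → ℕ} (hx : ∀ w, len w ≤ t + 1 → x w = x' w)
    (hid : ∀ w, len w ≤ t + 1 → ident w = ident' w) :
    A.ClaimsEdge n t i x ident ↔ A.ClaimsEdge n t i x' ident' := by
  rw [ClaimsEdge, ClaimsEdge, A.treeState_congr t hx hid, hid one (by rw [len_one]; omega),
    hid (letter i) (by rw [len_letter]; omega)]

/-- A solution contains no edge that both ends claim. -/
theorem not_claimsEdge_of_isSolution (he : Function.Injective e) (hid : Function.Injective ident)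
    (hball : ∀ w : RedWord, w.len ≤ R → w ∈ Set.range e)
    {P : (sinkInstance e ident).PortNumbering}
    (hP : ∀ v, (e v).len + 1 ≤ R →
      ∀ (i : Fin ((sinkInstance e ident).depGraph.degree v)) (j : Fin 4),
        i.val = j.val → e (P v i) = nbr (e v) j)
    (x : RedWord → unitInterval) {t : ℕ} (ht : t + 2 ≤ R)
    (hsol : (sinkInstance e ident).IsSolution
      (A.run (sinkInstance e ident) P (x ∘ e) t)) (i : Fin 4) :
    ¬ (((∃ j, A.ClaimsEdge n t j x ident) → A.ClaimsEdge n t i x ident) ∧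
      ((∃ j, A.ClaimsEdge n t j (x ∘ RedWord.flip i) (ident ∘ RedWord.flip i)) →
        A.ClaimsEdge n t i (x ∘ RedWord.flip i) (ident ∘ RedWord.flip i))) := by
  rintro ⟨h0, h1⟩
  have hclaim (v : Fin n) (hv : (e v).len ≤ 1) :
      ∃ j, A.ClaimsEdge n t j (x ∘ trans (e v)) (ident ∘ trans (e v)) := by
    have h := hsol.2.2 v
    -- A node that claims nothing has all its edges pointing to it, so its event occurs.
    contrapose! h
    rintro ⟨X, hX⟩
    obtain ⟨j, rfl⟩ := mem_edgeNames.1 hX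
    have h2 := not_not.1 (h j)
    rw [← A.stateAfter_eq_treeState he hid hball hP x t v (by omega)] at h2
    simp only [Function.comp_apply, trans_apply_one] at h2
    exact h2
  obtain ⟨u, hu⟩ := hball one (by rw [len_one]; omega)
  obtain ⟨v, hv⟩ := hball (letter i) (by rw [len_letter]; omega)
  have hu' := hclaim u (by rw [hu, len_one]; omega)
  have hv' := hclaim v (by rw [hv, len_letter])
  have hsu := A.stateAfter_eq_treeState he hid hball hP x t u (by rw [hu, len_one]; omega)
  have hsv := A.stateAfter_eq_treeState he hid hball hP x t v (by rw [hv, len_letter]; omega)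
  rw [hu, trans_one] at hu' hsu
  rw [hv, trans_letter] at hv' hsv
  have hcu := h0 hu'
  have hcv := h1 hv'
  rw [ClaimsEdge] at hcu hcv
  rw [← hsv] at hcv
  have e1 : RedWord.flip i one = letter i := rfl
  have e2 : RedWord.flip i (letter i) = one := lmul_lmul i one
  simp only [Function.comp_apply, e1, e2] at hcv
  rw [edgeName_comm] at hcv
  rw [show A.treeState n t x ident = _ from hsu.symm] at hcu
  set X := edgeName (ident one) (ident (letter i))
  have hXu : X ∈ (sinkInstance e ident).vbl u := mem_edgeNames.2 ⟨i, by rw [hu, nbr_one]⟩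
  have hXv : X ∈ (sinkInstance e ident).vbl v := mem_edgeNames.2
    ⟨i, by rw [hv, ← nbr_one, nbr_nbr, nbr_one, edgeName_comm]⟩
  have hagree := hsol.2.1 u v ((adj_sinkInstance he hid).2 ⟨i, by rw [hu, hv, nbr_one]⟩) X
    (Finset.mem_inter.2 ⟨hXu, hXv⟩)
  have hsupp := mem_support_fairCoin.1 (hsol.1 u X hXu)
  -- The common value of the edge is 0 or 1, so it points to one of the ends, and this end does not
  -- claim it.
  rcases pointTo_edgeName (fun h => letter_ne_one i (hid h).symm) hsupp with h | h
  · exact hcu h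
  · exact hcv (hagree.symm.trans h)

end LocalAlgorithm

end SinklessOrientation

/-! ### Trees with a prescribed number of nodes, and measurability of solutions. -/

open RedWord
open scoped ENNReal

/-- Any set of `n` words between two consecutive balls serves, so every `n` is covered, with radius
at least of order `log n`. -/
theorem RedWord.exists_embedding {n : ℕ} (hn : 1 ≤ n) : ∃ (R : ℕ) (e : Fin n → RedWord),
    n < 5 ^ (R + 1) ∧ Function.Injective e ∧ (∀ w : RedWord, w.len ≤ R → w ∈ Set.range e) ∧
      ∀ v, (e v).len ≤ R + 1 := by
  have hex : ∃ R, n < (ball R).card := ⟨n, lt_card_ball n⟩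
  obtain ⟨R, hR, hmin⟩ : ∃ R, n < (ball (R + 1)).card ∧ (ball R).card ≤ n := by
    have h0 : Nat.find hex ≠ 0 := fun h => by
      have h1 := Nat.find_spec hex
      have h2 := card_ball_le 0
      rw [h] at h1
      omega
    obtain ⟨R, hR⟩ := Nat.exists_eq_succ_of_ne_zero h0
    exact ⟨R, (congrArg (fun k => n < (ball k).card) hR).mp (Nat.find_spec hex), not_lt.1 (Nat.find_min hex (by omega))⟩
  obtain ⟨V, hV1, hV2, hVn⟩ := Finset.exists_subsuperset_card_eq
    (ball_mono (Nat.le_succ R)) hmin hR.le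
  let f : Fin n ≃ V := (V.equivFinOfCardEq hVn).symm
  refine ⟨R, fun v => (f v).1, hR.trans_le (card_ball_le _),
    Subtype.val_injective.comp f.injective, fun w hw => ?_, fun v => mem_ball.1 (hV2 (f v).2)⟩
  exact ⟨f.symm ⟨w, hV1 (mem_ball.2 hw)⟩, by simp⟩

theorem LLLInstance.measurableSet_isSolution {n : ℕ} (I : LLLInstance n) {α : Type}
    [MeasurableSpace α] {a : α → Fin n → ℕ → ℕ}
    (ha : ∀ v, ∀ X ∈ I.vbl v, Measurable fun x => a x v X) :
    MeasurableSet {x | I.IsSolution (a x)} := by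
  have h : {x | I.IsSolution (a x)} =
      (⋂ v, ⋂ X ∈ I.vbl v, {x | a x v X ∈ (I.law X).support}) ∩
      ((⋂ u, ⋂ v, ⋂ _ : I.depGraph.Adj u v, ⋂ X ∈ I.vbl u ∩ I.vbl v, {x | a x u X = a x v X}) ∩
      ⋂ v, {x | (fun X : I.vbl v => a x v X) ∈ (I.bad v)ᶜ}) := by
    ext x
    simp only [Set.mem_inter_iff, Set.mem_iInter, Set.mem_ofPred_eq, Set.mem_compl_iff]
    rfl
  rw [h]
  refine .inter (.iInter fun v => .biInter (Set.to_countable _) fun X hX =>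
    ha v X hX (Set.to_countable _).measurableSet) (.inter ?_ ?_)
  · refine .iInter fun u => .iInter fun v => .iInter fun _ =>
      .biInter (Finset.countable_toSet _) fun X hX => ?_
    rw [Finset.mem_coe, Finset.mem_inter] at hX
    exact measurableSet_eq_fun (ha u X hX.1) (ha v X hX.2)
  · refine .iInter fun v => ?_
    have : Measurable fun x => fun X : I.vbl v => a x v X :=
      measurable_pi_lambda _ fun X => ha v X X.2
    exact this (Set.to_countable _).measurableSet

/-! ### Random identifiers and the bound on the running time. -/

section RandomIdentifiers

variable {N : ℕ}

/-- The uniform law of an identifier below `N`. -/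
noncomputable def identLaw (N : ℕ) [NeZero N] : Measure (Fin N) :=
  (PMF.uniformOfFintype (Fin N)).toMeasure

instance [NeZero N] : IsProbabilityMeasure (identLaw N) :=
  inferInstanceAs (IsProbabilityMeasure (PMF.toMeasure _))

/-- The law of a random number together with a random identifier. -/
noncomputable def labelLaw (N : ℕ) [NeZero N] : Measure (unitInterval × Fin N) :=
  (volume : Measure unitInterval).prod (identLaw N)

instance [NeZero N] : IsProbabilityMeasure (labelLaw N) :=
  inferInstanceAs (IsProbabilityMeasure (Measure.prod _ _))

/-- Two of the words of length at most `k` have the same identifier. -/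
def identCollision (N k : ℕ) : Set (RedWord → unitInterval × Fin N) :=
  ⋃ u ∈ ball k, ⋃ v ∈ ball k, ⋃ _ : u ≠ v, {ω | (ω u).2 = (ω v).2}

theorem measurableSet_identCollision (k : ℕ) : MeasurableSet (identCollision N k) :=
  .biUnion (Finset.countable_toSet _) fun u _ => .biUnion (Finset.countable_toSet _) fun v _ =>
    .iUnion fun _ => measurableSet_eq_fun (by fun_prop) (by fun_prop)

theorem measure_identCollision_le [NeZero N] (k : ℕ) :
    iidMeasure (labelLaw N) RedWord (identCollision N k) ≤ (ball k).card ^ 2 * (N : ℝ≥0∞)⁻¹ := by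
  set P := iidMeasure (labelLaw N) RedWord
  have hpair {u v : RedWord} (h : u ≠ v) : P {ω | (ω u).2 = (ω v).2} = (N : ℝ≥0∞)⁻¹ := by
    have hm : Measurable fun ω : RedWord → unitInterval × Fin N => (ω u, ω v) := by fun_prop
    have hs : MeasurableSet {p : (unitInterval × Fin N) × (unitInterval × Fin N) |
        p.1.2 = p.2.2} := measurableSet_eq_fun (by fun_prop) (by fun_prop)
    have h1 : P {ω | (ω u).2 = (ω v).2} =
        ((labelLaw N).prod (labelLaw N)) {p | p.1.2 = p.2.2} := by
      rw [← Measure.infinitePi_map_eval_prod (P := fun _ : RedWord => labelLaw N) h,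
        Measure.map_apply hm hs]
      rfl
    have h2 (a : unitInterval × Fin N) :
        labelLaw N (Prod.mk a ⁻¹' {p | p.1.2 = p.2.2}) = (N : ℝ≥0∞)⁻¹ := by
      have : Prod.mk a ⁻¹' {p : (unitInterval × Fin N) × (unitInterval × Fin N) |
          p.1.2 = p.2.2} = Set.univ ×ˢ {a.2} := by
        ext b; simp [eq_comm]
      rw [this, labelLaw, Measure.prod_prod, measure_univ, one_mul, identLaw,
        PMF.toMeasure_apply_singleton _ _ (measurableSet_singleton _)]
      simp
    rw [h1, Measure.prod_apply hs]
    simp only [h2, lintegral_const, measure_univ, mul_one]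
  calc P (identCollision N k)
      ≤ ∑ u ∈ ball k, P (⋃ v ∈ ball k, ⋃ _ : u ≠ v, {ω | (ω u).2 = (ω v).2}) :=
        measure_biUnion_finset_le _ _
    _ ≤ ∑ u ∈ ball k, ∑ v ∈ ball k, P (⋃ _ : u ≠ v, {ω | (ω u).2 = (ω v).2}) :=
        Finset.sum_le_sum fun u _ => measure_biUnion_finset_le _ _
    _ ≤ ∑ _u ∈ ball k, ∑ _v ∈ ball k, (N : ℝ≥0∞)⁻¹ := by
        refine Finset.sum_le_sum fun u _ => Finset.sum_le_sum fun v _ => ?_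
        by_cases h : u = v
        · simp [h]
        · simpa [h] using (hpair h).le
    _ = _ := by simp only [Finset.sum_const, nsmul_eq_mul]; ring

/-- Random identifiers are distinct only in a ball, while `sinkInstance` is used with globally
injective ones. Values outside the ball are moved above all values inside. -/
theorem exists_injective_extension {k : ℕ} {f : RedWord → ℕ} (hf : Set.InjOn f {w | w.len ≤ k}) :
    ∃ g : RedWord → ℕ, Function.Injective g ∧ ∀ w, len w ≤ k → g w = f w := by
  obtain ⟨c, hc⟩ := Countable.exists_injective_nat RedWord
  obtain ⟨M, hM⟩ : ∃ M, ∀ w, len w ≤ k → f w < M := by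
    refine ⟨(ball k).sup f + 1, fun w hw => Nat.lt_succ_of_le ?_⟩
    exact Finset.le_sup (f := f) (mem_ball.2 hw)
  refine ⟨fun w => if w.len ≤ k then f w else M + c w, fun u v huv => ?_, fun w hw => if_pos hw⟩
  dsimp only at huv
  split_ifs at huv with h1 h2 h2
  · exact hf h1 h2 huv
  · have := hM u h1; omega
  · have := hM v h2; omega
  · exact hc (by omega)

namespace LocalAlgorithm

variable (A : LocalAlgorithm) (n t : ℕ)

/-- The root claims its edge of colour `i`, and the identifiers that it sees are distinct. -/
def ClaimsDistinct (i : Fin 4) (ω : RedWord → unitInterval × Fin N) : Prop :=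
  Set.InjOn (fun w => (ω w).2.val) {w | w.len ≤ t + 1} ∧
    A.ClaimsEdge n t i (fun w => (ω w).1) fun w => (ω w).2.val

/-- The root claims its edge of colour `i`, or it claims no edge. -/
def claimSet (N : ℕ) (i : Fin 4) : Set (RedWord → unitInterval × Fin N) :=
  {ω | (∃ j, A.ClaimsDistinct n t j ω) → A.ClaimsDistinct n t i ω}

theorem exists_mem_claimSet (ω : RedWord → unitInterval × Fin N) :
    ∃ i, ω ∈ A.claimSet n t N i := by
  by_cases h : ∃ j, A.ClaimsDistinct n t j ω
  · exact h.imp fun j hj _ => hj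
  · exact ⟨0, fun h' => absurd h' h⟩

theorem dependsOn_claimsDistinct (i : Fin 4) :
    DependsOn (A.ClaimsDistinct (N := N) n t i) {w | w.len ≤ t + 1} := by
  intro ω ω' h
  have h1 : Set.InjOn (fun w => (ω w).2.val) {w | w.len ≤ t + 1} ↔
      Set.InjOn (fun w => (ω' w).2.val) {w | w.len ≤ t + 1} :=
    Set.EqOn.injOn_iff fun w hw => by simp only [h w hw]
  have h2 := A.claimsEdge_congr (n := n) (t := t) i (x := fun w => (ω w).1)
    (x' := fun w => (ω' w).1) (ident := fun w => (ω w).2.val) (ident' := fun w => (ω' w).2.val)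
    (fun w hw => by rw [h w hw]) (fun w hw => by rw [h w hw])
  simp only [ClaimsDistinct, h1, h2]

theorem dependsOn_claimSet (i : Fin 4) :
    DependsOn (fun ω => ω ∈ A.claimSet n t N i) {w | w.len ≤ t + 1} := by
  intro ω ω' h
  have h1 (j) := A.dependsOn_claimsDistinct n t j h
  simp only [claimSet, Set.mem_ofPred_eq, h1]

variable {n t} {A} {f : ℕ → ℝ} {D : ℕ∞} {T : ℕ → ℕ} {c : ℝ} {e : Fin n → RedWord} {R : ℕ}

/-- The guarantee of the algorithm on the sinkless orientation problem. -/
theorem SolvesLLL.sinkInstance (hA : A.SolvesLLL f D T c) (hf : f 4 ≤ 16) (hD : 4 ≤ D)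
    {ident : RedWord → ℕ} (he : Function.Injective e) (hid : Function.Injective ident)
    (hball : ∀ w : RedWord, w.len ≤ R → w ∈ Set.range e) (hlen : ∀ v, (e v).len ≤ R + 1)
    (hR : 1 ≤ R) (P : (sinkInstance e ident).PortNumbering) :
    (∀ v, ∀ X ∈ (_root_.sinkInstance e ident).vbl v,
      Measurable fun x => A.run (_root_.sinkInstance e ident) P x (T n) v X) ∧
    1 - 1 / (n : ℝ) ^ c ≤ (volume : Measure (Fin n → unitInterval)).real
      {x | (_root_.sinkInstance e ident).IsSolution
        (A.run (_root_.sinkInstance e ident) P x (T n))} := by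
  have hmax := maxDegree_sinkInstance (ident := ident) he hid hball hR
  refine hA n _ (connected_sinkInstance he hid hball hlen)
    ⟨1 / 16, fun v => (prob_sinkInstance hid v).le, ?_⟩ ?_ P
  · rw [hmax]; linarith
  · rw [hmax]; exact hD

theorem SolvesLLL.measurableSet_claimsEdge (hA : A.SolvesLLL f D T c) (hf : f 4 ≤ 16)
    (hD : 4 ≤ D) (he : Function.Injective e)
    (hball : ∀ w : RedWord, w.len ≤ R → w ∈ Set.range e) (hlen : ∀ v, (e v).len ≤ R + 1)
    (hT : T n + 2 ≤ R) (i : Fin 4) {ident : RedWord → ℕ} (hid : Function.Injective ident) :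
    MeasurableSet {x | A.ClaimsEdge n (T n) i x ident} := by
  obtain ⟨P, hP⟩ := exists_portNumbering he hid hball
  obtain ⟨v, hv⟩ := hball one (by rw [len_one]; omega)
  set X := edgeName (ident one) (ident (letter i))
  have hX : X ∈ (_root_.sinkInstance e ident).vbl v := mem_edgeNames.2 ⟨i, by rw [hv, nbr_one]⟩
  have hm := (hA.sinkInstance hf hD he hid hball hlen (by omega) P).1 v X hX
  have hm' : Measurable fun x : RedWord → unitInterval =>
      A.run (_root_.sinkInstance e ident) P (x ∘ e) (T n) v X :=
    hm.comp (measurable_pi_lambda _ fun k => measurable_pi_apply (e k))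
  have : {x | A.ClaimsEdge n (T n) i x ident} = (fun x : RedWord → unitInterval =>
      A.run (_root_.sinkInstance e ident) P (x ∘ e) (T n) v X) ⁻¹' {pointTo (ident one) X}ᶜ := by
    ext x
    have h := A.stateAfter_eq_treeState he hid hball hP x (T n) v (by rw [hv, len_one]; omega)
    rw [hv, trans_one] at h
    simp only [run, h, Set.mem_preimage, Set.mem_compl_iff, Set.mem_singleton_iff]
    rfl
  rw [this]
  exact hm' (Set.to_countable _).measurableSet

/-- Measurability of the outputs is granted only on genuine instances, that is, for fixed injective
identifiers. This is why `ClaimsDistinct` demands distinctness; the finitely many identifier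
patterns in the visible ball are then treated separately. -/
theorem SolvesLLL.measurableSet_claimSet (hA : A.SolvesLLL f D T c) (hf : f 4 ≤ 16)
    (hD : 4 ≤ D) (he : Function.Injective e)
    (hball : ∀ w : RedWord, w.len ≤ R → w ∈ Set.range e) (hlen : ∀ v, (e v).len ≤ R + 1)
    (hT : T n + 2 ≤ R) (i : Fin 4) : MeasurableSet (A.claimSet n (T n) N i) := by
  have hc (i : Fin 4) : MeasurableSet
      {ω : RedWord → unitInterval × Fin N | A.ClaimsDistinct n (T n) i ω} := by
    let r (ω : RedWord → unitInterval × Fin N) : ball (T n + 1) → Fin N := fun w => (ω w).2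
    have hr : Measurable r := by fun_prop
    have : {ω : RedWord → unitInterval × Fin N | A.ClaimsDistinct n (T n) i ω} =
        ⋃ κ : ball (T n + 1) → Fin N, r ⁻¹' {κ} ∩ {ω | A.ClaimsDistinct n (T n) i ω} := by
      ext ω; simp
    rw [this]
    refine .iUnion fun κ => ?_
    by_cases hκ : ∃ ω₀, r ω₀ = κ ∧ A.ClaimsDistinct n (T n) i ω₀
    · obtain ⟨ω₀, rfl, h0⟩ := hκ
      obtain ⟨g, hg, hg'⟩ := exists_injective_extension h0.1
      have heq : r ⁻¹' {r ω₀} ∩ {ω | A.ClaimsDistinct n (T n) i ω} = r ⁻¹' {r ω₀} ∩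
          (fun ω w => (ω w).1) ⁻¹' {x | A.ClaimsEdge n (T n) i x g} := by
        ext ω
        refine and_congr_right fun hω => ?_
        have hω' (w : RedWord) (hw : w.len ≤ T n + 1) : (ω w).2.val = g w := by
          rw [hg' w hw]
          exact congrArg Fin.val (congrFun hω ⟨w, mem_ball.2 hw⟩)
        have hinj : Set.InjOn (fun w => (ω w).2.val) {w | w.len ≤ T n + 1} :=
          hg.injOn.congr fun w hw => (hω' w hw).symm
        exact (and_iff_right hinj).trans
          (A.claimsEdge_congr i (fun _ _ => rfl) hω')
      rw [heq]
      exact (hr (measurableSet_singleton _)).inter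
        ((hA.measurableSet_claimsEdge hf hD he hball hlen hT i hg).preimage (by fun_prop))
    · convert MeasurableSet.empty
      rw [Set.eq_empty_iff_forall_notMem]
      exact fun ω hω => hκ ⟨ω, hω.1, hω.2⟩
  have : A.claimSet n (T n) N i =
      (⋃ j, {ω | A.ClaimsDistinct n (T n) j ω})ᶜ ∪ {ω | A.ClaimsDistinct n (T n) i ω} := by
    ext ω
    simp only [claimSet, Set.mem_ofPred_eq, Set.mem_union, Set.mem_compl_iff, Set.mem_iUnion]
    exact imp_iff_not_or
  rw [this]
  exact (MeasurableSet.iUnion hc).compl.union (hc i)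

theorem measurePreserving_randomNumbers [NeZero N] (he : Function.Injective e) :
    MeasurePreserving (fun (ω : RedWord → unitInterval × Fin N) k => (ω (e k)).1)
      (iidMeasure (labelLaw N) RedWord) (volume : Measure (Fin n → unitInterval)) := by
  refine ⟨by fun_prop, ?_⟩
  have h1 := Measure.map_infinitePi_infinitePi_of_inj (P := fun _ : RedWord => labelLaw N) he
  have h2 := Measure.infinitePi_map_pi (fun _ : Fin n => labelLaw N)
    (f := fun _ => (Prod.fst : unitInterval × Fin N → unitInterval)) fun _ => measurable_fst
  have h3 : (labelLaw N).map Prod.fst = (volume : Measure unitInterval) :=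
    measurePreserving_fst.map_eq
  rw [← h1, Measure.map_map (by fun_prop) (by fun_prop)] at h2
  simp only [h3, Measure.infinitePi_eq_pi] at h2
  exact h2

/-- For distinct identifiers, both ends of an edge claim it only if the algorithm fails. -/
theorem SolvesLLL.measure_claimSet_of_ident_le [NeZero N] (hA : A.SolvesLLL f D T c)
    (hf : f 4 ≤ 16) (hD : 4 ≤ D) (he : Function.Injective e)
    (hball : ∀ w : RedWord, w.len ≤ R → w ∈ Set.range e) (hlen : ∀ v, (e v).len ≤ R + 1)
    (hT : T n + 2 ≤ R) (i : Fin 4) {ω' : RedWord → unitInterval × Fin N}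
    (hω' : ω' ∉ identCollision N (T n + 2)) :
    iidMeasure (labelLaw N) RedWord {ω | (fun w => ((ω w).1, (ω' w).2)) ∈
      A.claimSet n (T n) N i ∩ shiftSet i (A.claimSet n (T n) N i)} ≤
      ENNReal.ofReal (1 / (n : ℝ) ^ c) := by
  have hinj : Set.InjOn (fun w => (ω' w).2.val) {w | w.len ≤ T n + 2} := by
    intro u hu v hv huv
    by_contra h
    refine hω' ?_
    simp only [identCollision, Set.mem_iUnion]
    exact ⟨u, mem_ball.2 hu, v, mem_ball.2 hv, h, Fin.ext huv⟩
  obtain ⟨g, hg, hg'⟩ := exists_injective_extension hinj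
  obtain ⟨P, hP⟩ := exists_portNumbering he hg hball
  obtain ⟨hm, hprob⟩ := hA.sinkInstance hf hD he hg hball hlen (by omega) P
  set Sol := {x | (_root_.sinkInstance e g).IsSolution
    (A.run (_root_.sinkInstance e g) P x (T n))}
  have hSol : MeasurableSet Sol := (_root_.sinkInstance e g).measurableSet_isSolution hm
  have hsub : {ω : RedWord → unitInterval × Fin N | (fun w => ((ω w).1, (ω' w).2)) ∈
      A.claimSet n (T n) N i ∩ shiftSet i (A.claimSet n (T n) N i)} ⊆
      (fun (ω : RedWord → unitInterval × Fin N) k => (ω (e k)).1) ⁻¹' Solᶜ := by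
    rintro ω ⟨h1, h2⟩ hsol
    -- Used for `φ = id` and `φ = flip i`, the views from the two ends; the second reaches radius `T
    -- n + 2` around the root.
    have key (φ : RedWord → RedWord) (hφ : ∀ w, len w ≤ T n + 1 → (φ w).len ≤ T n + 2)
        (hφi : Function.Injective φ) (j : Fin 4) :
        A.ClaimsDistinct n (T n) j (fun w => ((ω (φ w)).1, (ω' (φ w)).2)) ↔
          A.ClaimsEdge n (T n) j ((fun w => (ω w).1) ∘ φ) (g ∘ φ) := by
      have hinj' : Set.InjOn (fun w => (ω' (φ w)).2.val) {w | w.len ≤ T n + 1} :=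
        fun u hu v hv huv => hφi (hinj (hφ u hu) (hφ v hv) huv)
      exact (and_iff_right hinj').trans (A.claimsEdge_congr j (fun _ _ => rfl)
        fun w hw => (hg' _ (hφ w hw)).symm)
    have k1 := key id (fun w hw => hw.trans (Nat.le_succ _)) Function.injective_id
    have k2 := key (RedWord.flip i) (fun w hw => (len_lmul_le i w).trans (by omega))
      (RedWord.flip i).injective
    refine A.not_claimsEdge_of_isSolution he hg hball hP (fun w => (ω w).1) hT hsol i ⟨?_, ?_⟩
    · rintro ⟨j, hj⟩
      exact (k1 i).1 (h1 ⟨j, (k1 j).2 hj⟩)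
    · rintro ⟨j, hj⟩
      exact (k2 i).1 (h2 ⟨j, (k2 j).2 hj⟩)
  calc _ ≤ iidMeasure (labelLaw N) RedWord
        ((fun (ω : RedWord → unitInterval × Fin N) k => (ω (e k)).1) ⁻¹' Solᶜ) :=
        measure_mono hsub
    _ = volume Solᶜ :=
        (measurePreserving_randomNumbers he).measure_preimage hSol.compl.nullMeasurableSet
    _ = ENNReal.ofReal (volume.real Solᶜ) := by rw [ofReal_measureReal]
    _ ≤ _ := by
        refine ENNReal.ofReal_le_ofReal ?_
        rw [probReal_compl_eq_one_sub hSol]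
        linarith

/-- Random numbers from one sample and identifiers from an independent one have the joint law of a
single sample. Fubini then permits fixing the identifiers, and collisions are paid for separately.
-/
theorem SolvesLLL.measure_claimSet_le [NeZero N] (hA : A.SolvesLLL f D T c)
    (hf : f 4 ≤ 16) (hD : 4 ≤ D) (he : Function.Injective e)
    (hball : ∀ w : RedWord, w.len ≤ R → w ∈ Set.range e) (hlen : ∀ v, (e v).len ≤ R + 1)
    (hT : T n + 2 ≤ R) (i : Fin 4) :
    iidMeasure (labelLaw N) RedWord
      (A.claimSet n (T n) N i ∩ shiftSet i (A.claimSet n (T n) N i)) ≤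
      (ball (T n + 2)).card ^ 2 * (N : ℝ≥0∞)⁻¹ + ENNReal.ofReal (1 / (n : ℝ) ^ c) := by
  set P := iidMeasure (labelLaw N) RedWord
  have hC := hA.measurableSet_claimSet (N := N) hf hD he hball hlen hT i
  set E := A.claimSet n (T n) N i ∩ shiftSet i (A.claimSet n (T n) N i)
  have hE : MeasurableSet E := hC.inter (measurableSet_shiftSet i hC)
  have hmix : MeasurePreserving
      (fun p : (RedWord → unitInterval × Fin N) × (RedWord → unitInterval × Fin N) =>
        fun w => ((p.1 w).1, (p.2 w).2)) (P.prod P) P :=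
    iidMeasure_zipWith (μ := labelLaw N) (φ := fun _ p => (p.1.1, p.2.2)) fun _ =>
      measurePreserving_fst.prod measurePreserving_snd
  have hcol := measurableSet_identCollision (N := N) (T n + 2)
  calc P E = (P.prod P) _ := (hmix.measure_preimage hE.nullMeasurableSet).symm
    _ = ∫⁻ ω', P {ω | (fun w => ((ω w).1, (ω' w).2)) ∈ E} ∂P :=
        Measure.prod_apply_symm (hmix.measurable hE)
    _ ≤ ∫⁻ ω', ((identCollision N (T n + 2)).indicator 1 ω' +
          ENNReal.ofReal (1 / (n : ℝ) ^ c)) ∂P := by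
        refine lintegral_mono fun ω' => ?_
        by_cases h : ω' ∈ identCollision N (T n + 2)
        · rw [Set.indicator_of_mem h]
          exact prob_le_one.trans le_self_add
        · exact (hA.measure_claimSet_of_ident_le hf hD he hball hlen hT i h).trans le_add_self
    _ = P (identCollision N (T n + 2)) + ENNReal.ofReal (1 / (n : ℝ) ^ c) := by
        rw [lintegral_add_right _ measurable_const, lintegral_indicator_one hcol,
          lintegral_const, measure_univ, mul_one]
    _ ≤ _ := by gcongr; exact measure_identCollision_le _

/-- The failure probability of an algorithm with running time less than the radius of the tree is
at least `2 ^ -O(8 ^ T)`. -/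
theorem SolvesLLL.le_failure (hA : A.SolvesLLL f D T c)
    (hf : f 4 ≤ 16) (hD : 4 ≤ D) (he : Function.Injective e)
    (hball : ∀ w : RedWord, w.len ≤ R → w ∈ Set.range e) (hlen : ∀ v, (e v).len ≤ R + 1)
    (hT : T n + 2 ≤ R) :
    (2⁻¹ : ℝ≥0∞) ^ (6 * 8 ^ (T n + 1) - 2) ≤ ENNReal.ofReal (1 / (n : ℝ) ^ c) := by
  have key (N : ℕ) : (2⁻¹ : ℝ≥0∞) ^ (6 * 8 ^ (T n + 1) - 2) ≤
      (ball (T n + 2)).card ^ 2 * ((N + 1 : ℕ) : ℝ≥0∞)⁻¹ + ENNReal.ofReal (1 / (n : ℝ) ^ c) := by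
    obtain ⟨i, hi⟩ := exists_le_measure_inter_shiftSet (μ := labelLaw (N + 1)) (T n + 1)
      (C := A.claimSet n (T n) (N + 1))
      (hA.measurableSet_claimSet hf hD he hball hlen hT) (A.exists_mem_claimSet n (T n))
      (A.dependsOn_claimSet n (T n))
    exact hi.trans (hA.measure_claimSet_le hf hD he hball hlen hT i)
  -- The algorithm, `n` and the ball do not depend on `N`, so the collision term vanishes in the
  -- limit.
  have hlim : Tendsto (fun N : ℕ => ((ball (T n + 2)).card : ℝ≥0∞) ^ 2 *
      ((N + 1 : ℕ) : ℝ≥0∞)⁻¹ + ENNReal.ofReal (1 / (n : ℝ) ^ c)) atTop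
      (nhds (((ball (T n + 2)).card : ℝ≥0∞) ^ 2 * 0 + ENNReal.ofReal (1 / (n : ℝ) ^ c))) :=
    (ENNReal.Tendsto.const_mul ((tendsto_add_atTop_iff_nat 1).2
      ENNReal.tendsto_inv_nat_nhds_zero) (Or.inr (by simp))).add tendsto_const_nhds
  rw [mul_zero, zero_add] at hlim
  exact ge_of_tendsto' hlim key

/-- Either the views near the root miss the boundary and `le_failure` applies, or `T n` exceeds the
radius up to a constant and `log n = O(T n)` holds outright. The factor `min c 1` serves both cases.
-/
theorem SolvesLLL.mul_log_le (hA : A.SolvesLLL f D T c) (hf : f 4 ≤ 16) (hD : 4 ≤ D)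
    (hn : 1 ≤ n) : min c 1 * Real.log n ≤ 48 * 8 ^ T n := by
  obtain ⟨R, e, hR, he, hball, hlen⟩ := RedWord.exists_embedding hn
  have hn0 : (0 : ℝ) < n := by exact_mod_cast hn
  have hlog : 0 ≤ Real.log n := Real.log_nonneg (by exact_mod_cast hn)
  by_cases hT : T n + 2 ≤ R
  · have h := hA.le_failure hf hD he hball hlen hT
    have hpos : (0 : ℝ) < (n : ℝ) ^ c := Real.rpow_pos_of_pos hn0 c
    set m := 6 * 8 ^ (T n + 1) - 2
    have h2 : (2⁻¹ : ℝ) ^ m ≤ 1 / (n : ℝ) ^ c := by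
      have := ENNReal.toReal_mono ENNReal.ofReal_ne_top h
      rwa [ENNReal.toReal_ofReal (by positivity), ENNReal.toReal_pow, ENNReal.toReal_inv,
        ENNReal.toReal_ofNat] at this
    have h3 : (n : ℝ) ^ c ≤ 2 ^ m := by
      rw [one_div, inv_pow] at h2
      exact (inv_le_inv₀ (by positivity) hpos).1 h2
    have h4 := Real.log_le_log hpos h3
    rw [Real.log_rpow hn0, Real.log_pow] at h4
    have h5 : (m : ℝ) ≤ 48 * 8 ^ T n := by
      have : m ≤ 48 * 8 ^ T n := by simp only [m, pow_succ]; omega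
      exact_mod_cast this
    calc min c 1 * Real.log n ≤ c * Real.log n := by gcongr; exact min_le_left _ _
      _ ≤ m * Real.log 2 := h4
      _ ≤ m * 1 := by
        gcongr
        linarith [Real.log_two_lt_d9]
      _ ≤ _ := by rw [mul_one]; exact h5
  · have h1 : (n : ℝ) ≤ 5 ^ (T n + 2) := by
      have : n ≤ 5 ^ (T n + 2) := hR.le.trans (Nat.pow_le_pow_right (by norm_num) (by omega))
      exact_mod_cast this
    have h2 := Real.log_le_log hn0 h1
    rw [Real.log_pow] at h2
    have h5 : Real.log 5 ≤ 4 := (Real.log_le_sub_one_of_pos (by norm_num)).trans (by norm_num)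
    have h6 : ((T n + 2 : ℕ) : ℝ) * 4 ≤ 48 * 8 ^ T n := by
      have h7 := Nat.lt_pow_self (n := T n) (a := 8) (by norm_num)
      have : (T n + 2) * 4 ≤ 48 * 8 ^ T n := by omega
      exact_mod_cast this
    calc min c 1 * Real.log n ≤ 1 * Real.log n := by gcongr; exact min_le_right _ _
      _ ≤ ((T n + 2 : ℕ) : ℝ) * Real.log 5 := by rw [one_mul]; exact h2
      _ ≤ ((T n + 2 : ℕ) : ℝ) * 4 := by gcongr
      _ ≤ _ := h6

end LocalAlgorithm

end RandomIdentifiers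

theorem mainTheorem1 (f : ℕ → ℝ) (hf : f 4 ≤ 16) (D : ℕ∞) (hD : 4 ≤ D)
    (A : LocalAlgorithm) (T : ℕ → ℕ) (c : ℝ) (hc : 0 < c) (hA : A.SolvesLLL f D T c) :
    (fun n : ℕ => Real.log (Real.log n)) =O[atTop] (fun n : ℕ => (T n : ℝ)) := by
  have hc' : 0 < min c 1 := lt_min hc one_pos
  set K := Real.log (48 / min c 1)
  have hlog : Tendsto (fun n : ℕ => Real.log n) atTop atTop :=
    Real.tendsto_log_atTop.comp tendsto_natCast_atTop_atTop
  have hloglog : Tendsto (fun n : ℕ => Real.log (Real.log n)) atTop atTop :=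
    Real.tendsto_log_atTop.comp hlog
  -- From `log (log n) ≤ K + 7 * T n` and, eventually, `K ≤ log (log n) / 2`.
  refine IsBigO.of_bound 14 ?_
  filter_upwards [hloglog.eventually_ge_atTop (2 * K), hloglog.eventually_ge_atTop 0,
    hlog.eventually_gt_atTop 0, eventually_ge_atTop 1] with n h1 h2 h3 hn
  rw [Real.norm_of_nonneg h2, Real.norm_of_nonneg (Nat.cast_nonneg _)]
  have h4 : Real.log n ≤ 48 / min c 1 * 8 ^ T n := by
    have := hA.mul_log_le hf hD hn
    rw [div_mul_eq_mul_div, le_div_iff₀ hc']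
    linarith
  have h5 := Real.log_le_log h3 h4
  rw [Real.log_mul (by positivity) (by positivity), Real.log_pow] at h5
  have h6 : Real.log 8 ≤ 7 := (Real.log_le_sub_one_of_pos (by norm_num)).trans (by norm_num)
  have h7 : (T n : ℝ) * Real.log 8 ≤ T n * 7 := by gcongr
  linarith
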